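/- Lemma 2.1 (Extension Lemma). Let $n\ge 5$ and $k\ge 4$. There is a constant $C>0$, depending only on $n$ and $k$, such that the following holds. Let $\Omega\subset\mathbb R^n$ be a bounded smooth domain, and let $v\in W^{2,2}(\Omega,\mathbb R^{k+1})$ satisfy $\int_\Omega|\nabla v|^4\,dx<\infty$, $|v(x)|=1$ and $\nabla v(x)\in T_{v(x)}S^k$ (that is, $\langle v(x),\partial_i v(x)\rangle=0$ for $i=1,\dots,n$) for a.e. $x\in\partial\Omega$, where $v$ and $\nabla v$ on $\partial\Omega$ are understood in the sense of traces. Then there is a map $w\in W^{2,2}(\Omega,S^k)$, i.e. $w\in W^{2,2}(\Omega,\mathbb R^{k+1})$ with $|w|=1$ a.e. in $\Omega$, such that $w=v$ and $\nabla w=\nabla v$ on $\partial\Omega$ in the sense of traces, and $$\int_\Omega|\Delta w|^2\,dx\le C\int_\Omega\left(|\Delta v|^2+|\nabla v|^4\right)dx .$$ -/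

import Mathlib

open MeasureTheory Set Filter Topology
open scoped ContDiff ENNReal

namespace SphereExtension

/-- A bounded smooth domain of `ℝⁿ`: a nonempty, connected, bounded open set which near each of its
boundary points is the sublevel set `{ρ < 0}` of a smooth function `ρ` with `dρ ≠ 0` there. -/
structure IsBoundedSmoothDomain {n : ℕ} (Ω : Set (EuclideanSpace ℝ (Fin n))) : Prop where
  isOpen : IsOpen Ω
  isConnected : IsConnected Ω
  isBounded : Bornology.IsBounded Ω
  smooth : ∀ x ∈ frontier Ω, ∃ U ∈ 𝓝 x, ∃ ρ : EuclideanSpace ℝ (Fin n) → ℝ,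
    ContDiff ℝ ∞ ρ ∧ fderiv ℝ ρ x ≠ 0 ∧ ∀ y ∈ U, (y ∈ Ω ↔ ρ y < 0)

section

variable {n : ℕ} {F : Type*} [NormedAddCommGroup F] [NormedSpace ℝ F]

/-- The classical partial derivative `∂ᵢ f`. -/
noncomputable def partialDeriv (i : Fin n) (f : EuclideanSpace ℝ (Fin n) → F) :
    EuclideanSpace ℝ (Fin n) → F :=
  fun x => fderiv ℝ f x (EuclideanSpace.single i 1)

/-- `f ∈ W^{1,2}(Ω, F)`, with weak partial derivatives `∂ᵢ f = Df i` in `Ω`: `f` and all `Df i`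
are square integrable, and `∫_Ω (∂ᵢφ) f = - ∫_Ω φ (Df i)` for all `φ ∈ C_c^∞(Ω)`. -/
structure IsW12 (Ω : Set (EuclideanSpace ℝ (Fin n))) (f : EuclideanSpace ℝ (Fin n) → F)
    (Df : Fin n → EuclideanSpace ℝ (Fin n) → F) : Prop where
  memLp : MemLp f 2 (volume.restrict Ω)
  memLp_deriv : ∀ i, MemLp (Df i) 2 (volume.restrict Ω)
  weakDeriv : ∀ (i : Fin n) (φ : EuclideanSpace ℝ (Fin n) → ℝ), ContDiff ℝ ∞ φ →
    HasCompactSupport φ → tsupport φ ⊆ Ω →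
    ∫ x in Ω, partialDeriv i φ x • f x = - ∫ x in Ω, φ x • Df i x

/-- `f ∈ W^{2,2}(Ω, F)`, with first weak partial derivatives `∂ᵢ f = Df i` and second weak partial
derivatives `∂ⱼ∂ᵢ f = D2f i j`. -/
structure IsW22 (Ω : Set (EuclideanSpace ℝ (Fin n))) (f : EuclideanSpace ℝ (Fin n) → F)
    (Df : Fin n → EuclideanSpace ℝ (Fin n) → F)
    (D2f : Fin n → Fin n → EuclideanSpace ℝ (Fin n) → F) : Prop where
  isW12 : IsW12 Ω f Df
  isW12_deriv : ∀ i, IsW12 Ω (Df i) (D2f i)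

/-- The surface measure on `∂Ω`: the `(n-1)`-dimensional Hausdorff measure on the boundary (up to
a constant factor depending only on `n`, which affects neither null sets nor `L²(∂Ω)`
convergence). -/
noncomputable def surfaceMeasure (Ω : Set (EuclideanSpace ℝ (Fin n))) :
    Measure (EuclideanSpace ℝ (Fin n)) :=
  (Measure.hausdorffMeasure ((n : ℝ) - 1)).restrict (frontier Ω)

/-- `g ∈ L²(∂Ω, F)` is the trace on `∂Ω` of the `W^{1,2}(Ω, F)` function `f` with weak partial
derivatives `Df`. The trace operator is the continuous extension to `W^{1,2}(Ω)` of the restriction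
`φ ↦ φ|_∂Ω` of functions smooth up to the boundary, with values in `L²(∂Ω)`: so `g` is the trace of
`f` when some sequence of smooth functions on `ℝⁿ` converges to `f` in `W^{1,2}(Ω)` while its
restrictions to `∂Ω` converge to `g` in `L²(∂Ω)`. -/
def HasTrace (Ω : Set (EuclideanSpace ℝ (Fin n))) (f : EuclideanSpace ℝ (Fin n) → F)
    (Df : Fin n → EuclideanSpace ℝ (Fin n) → F) (g : EuclideanSpace ℝ (Fin n) → F) : Prop :=
  MemLp g 2 (surfaceMeasure Ω) ∧
  ∃ φ : ℕ → EuclideanSpace ℝ (Fin n) → F, (∀ m, ContDiff ℝ ∞ (φ m)) ∧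
    Tendsto (fun m => eLpNorm (φ m - f) 2 (volume.restrict Ω)) atTop (𝓝 0) ∧
    (∀ i, Tendsto (fun m => eLpNorm (partialDeriv i (φ m) - Df i) 2 (volume.restrict Ω))
      atTop (𝓝 0)) ∧
    Tendsto (fun m => eLpNorm (φ m - g) 2 (surfaceMeasure Ω)) atTop (𝓝 0)

/-- The Laplacian `Δf = ∑ᵢ ∂ᵢ∂ᵢ f` in terms of the second partial derivatives. -/
def laplacian (D2f : Fin n → Fin n → EuclideanSpace ℝ (Fin n) → F)
    (x : EuclideanSpace ℝ (Fin n)) : F :=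
  ∑ i, D2f i i x

/-- `|∇f|² = ∑ᵢ |∂ᵢ f|²` in terms of the first partial derivatives. -/
def gradNormSq (Df : Fin n → EuclideanSpace ℝ (Fin n) → F) (x : EuclideanSpace ℝ (Fin n)) : ℝ :=
  ∑ i, ‖Df i x‖ ^ 2

end

end SphereExtension

/-!
The map `w` is `v` followed by the projection of `ℝᵏ⁺¹ \ {a}` onto the unit sphere along rays from
a point `a` with `|a| ≤ 1/2` (`rayProj`). This projection fixes the sphere, so its differential
fixes tangent vectors (`fderiv_rayProj_sub_apply`) and `w` has the boundary data of `v`. By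
homogeneity its first and second derivatives at `y` are at most `C |y - a|⁻¹` and `C |y - a|⁻²`,
uniformly in `a` (`exists_fderiv_rayProj_bound`), whence
`|Δw|² ≤ C (|v - a|⁻² |Δv|² + |v - a|⁻⁴ |∇v|⁴)`. As `4 < k + 1`, the weights have integrals over
`a ∈ B_{1/2}` which are bounded uniformly in the value of `v`, so by Fubini some centre satisfies
the required estimate (`exists_center`). The centre can moreover be taken in the set of full measure
for which the whole Hessian of `w` is square integrable.

That `w` is in `W^{2,2}` and has the right traces needs no theory of traces beyond the definition:
the smooth functions provided by the traces of `v` and `∂ᵢv` serve as approximations throughout.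
Composing them with a smooth map with bounded differential gives the chain rule (`HasTrace.comp`);
for the product `DΦ(v) ∂ᵢv` it is applied to the pair `(v, ∂ᵢv)` after truncating `∂ᵢv`, and the
truncation is removed by means of `∇v ∈ L⁴` (`HasTrace.fderiv_comp_apply`). Finally the projection
is a limit of smooth maps with the same derivative bounds which agree with it near the sphere
(`exists_smooth_approx_rayProj`), and the graph of the trace is closed (`HasTrace.of_tendsto`). Weak
derivatives come for free, because functions with a trace are limits of smooth functions
(`HasTrace.isW12`).
-/

namespace SphereExtension

/-! ### Limits in `L²` -/

section LpLimits

variable {α F : Type*} [MeasurableSpace α] {μ : Measure α} [NormedAddCommGroup F]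

/-- Dominated convergence in `L²`. -/
theorem tendsto_eLpNorm_two_of_dominated {f : ℕ → α → F} {f₀ : α → F} {h : α → ℝ}
    (hf : ∀ m, AEStronglyMeasurable (f m) μ) (hh : MemLp h 2 μ)
    (hb : ∀ m, ∀ᵐ x ∂μ, ‖f m x‖ ≤ h x)
    (hlim : ∀ᵐ x ∂μ, Tendsto (fun m => f m x) atTop (𝓝 (f₀ x))) :
    MemLp f₀ 2 μ ∧ Tendsto (fun m => eLpNorm (f m - f₀) 2 μ) atTop (𝓝 0) := by
  have hf₀ : AEStronglyMeasurable f₀ μ := aestronglyMeasurable_of_tendsto_ae atTop hf hlim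
  have hb' : ∀ᵐ x ∂μ, ∀ m, ‖f m x‖ ≤ h x := ae_all_iff.2 hb
  have hb₀ : ∀ᵐ x ∂μ, ‖f₀ x‖ ≤ h x := by
    filter_upwards [hb', hlim] with x hx hl
    exact le_of_tendsto hl.norm (Eventually.of_forall hx)
  refine ⟨hh.of_le hf₀ (hb₀.mono fun x hx => hx.trans (le_abs_self _)), ?_⟩
  have key : Tendsto (fun m => ∫⁻ x, ‖(f m - f₀) x‖ₑ ^ (2 : ℝ) ∂μ) atTop (𝓝 0) := by
    have h2 : MemLp (fun x => 2 * h x) 2 μ := hh.const_mul 2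
    have := tendsto_lintegral_of_dominated_convergence' (μ := μ)
      (F := fun m x => ‖(f m - f₀) x‖ₑ ^ (2 : ℝ)) (f := fun _ => 0)
      (fun x => ‖2 * h x‖ₑ ^ (2 : ℝ))
      (fun m => ((hf m).sub hf₀).enorm.pow_const _) ?_ ?_ ?_
    · simpa using this
    · intro m
      filter_upwards [hb', hb₀] with x hx hx0
      refine ENNReal.rpow_le_rpow ?_ (by norm_num)
      refine enorm_le_iff_norm_le.2 ?_
      refine (norm_sub_le _ _).trans ?_
      have := hx m
      rw [Real.norm_eq_abs]
      refine le_trans ?_ (le_abs_self _)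
      linarith
    · have := lintegral_rpow_enorm_lt_top_of_eLpNorm_lt_top (p := 2) (by norm_num) (by norm_num)
        h2.eLpNorm_lt_top
      simpa using this.ne
    · filter_upwards [hlim] with x hx
      have h0 : Tendsto (fun m => f m x - f₀ x) atTop (𝓝 0) := by
        simpa using hx.sub_const (f₀ x)
      have h1 : Tendsto (fun m => ‖f m x - f₀ x‖ₑ) atTop (𝓝 0) := by
        simpa using h0.enorm
      have := (ENNReal.continuous_rpow_const (y := (2 : ℝ))).continuousAt.tendsto.comp h1
      simpa [Function.comp_def] using this
  have := (ENNReal.continuous_rpow_const (y := (1 / 2 : ℝ))).continuousAt.tendsto.comp key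
  simp only [ENNReal.zero_rpow_of_pos (show (0 : ℝ) < 1 / 2 by norm_num)] at this
  refine this.congr fun m => ?_
  rw [eLpNorm_eq_lintegral_rpow_enorm_toReal (by norm_num) (by norm_num)]
  simp

theorem memLp_of_tendsto_eLpNorm {f : ℕ → α → F} {f₀ : α → F} {p : ℝ≥0∞}
    (hf : ∀ m, MemLp (f m) p μ) (hf₀ : AEStronglyMeasurable f₀ μ)
    (h : Tendsto (fun m => eLpNorm (f m - f₀) p μ) atTop (𝓝 0)) : MemLp f₀ p μ := by
  obtain ⟨m, hm⟩ := (h.eventually (gt_mem_nhds ENNReal.zero_lt_top)).exists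
  have h1 : MemLp (f m - f₀) p μ := ⟨(hf m).1.sub hf₀, hm⟩
  simpa using (hf m).sub h1

theorem tendsto_integral_smul_of_tendsto_eLpNorm_two [NormedSpace ℝ F] {ψ : α → ℝ}
    (hψ : MemLp ψ 2 μ) {f : ℕ → α → F} {f₀ : α → F} (hf₀ : MemLp f₀ 2 μ)
    (hf : ∀ m, AEStronglyMeasurable (f m) μ)
    (h : Tendsto (fun m => eLpNorm (f m - f₀) 2 μ) atTop (𝓝 0)) :
    Tendsto (fun m => ∫ x, ψ x • f m x ∂μ) atTop (𝓝 (∫ x, ψ x • f₀ x ∂μ)) := by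
  have hb : ∀ m, eLpNorm (fun x => ψ x • f m x - ψ x • f₀ x) 1 μ
      ≤ eLpNorm ψ 2 μ * eLpNorm (f m - f₀) 2 μ := by
    intro m
    have := eLpNorm_smul_le_mul_eLpNorm (p := 2) (q := 2) (r := 1) ((hf m).sub hf₀.1) hψ.1
    refine le_trans (le_of_eq ?_) this
    congr 1
    ext x
    simp [smul_sub]
  have hlim : Tendsto (fun m => eLpNorm ψ 2 μ * eLpNorm (f m - f₀) 2 μ) atTop (𝓝 0) := by
    have := ENNReal.Tendsto.const_mul h (Or.inr hψ.eLpNorm_ne_top)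
    simpa using this
  have h1 : Tendsto (fun m => eLpNorm (fun x => ψ x • f m x - ψ x • f₀ x) 1 μ) atTop (𝓝 0) :=
    tendsto_of_tendsto_of_tendsto_of_le_of_le tendsto_const_nhds hlim (fun _ => zero_le) hb
  have hint : Integrable (fun x => ψ x • f₀ x) μ := memLp_one_iff_integrable.1 (hf₀.smul hψ)
  refine tendsto_integral_of_L1' _ hint.aestronglyMeasurable ?_ h1
  filter_upwards [h1.eventually (gt_mem_nhds ENNReal.zero_lt_top)] with m hm
  have : MemLp (fun x => ψ x • f m x - ψ x • f₀ x) 1 μ :=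
    ⟨(hψ.1.smul (hf m)).sub (hψ.1.smul hf₀.1), hm⟩
  have := (memLp_one_iff_integrable.1 this).add hint
  simpa [Pi.add_def] using this

end LpLimits

/-! ### Traces and weak derivatives -/

section Trace

variable {n : ℕ} {F : Type*} [NormedAddCommGroup F] [NormedSpace ℝ F]
  {Ω : Set (EuclideanSpace ℝ (Fin n))} {f : EuclideanSpace ℝ (Fin n) → F}
  {Df : Fin n → EuclideanSpace ℝ (Fin n) → F} {g : EuclideanSpace ℝ (Fin n) → F}

theorem continuous_partialDeriv {φ : EuclideanSpace ℝ (Fin n) → F} (hφ : ContDiff ℝ ∞ φ)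
    (i : Fin n) : Continuous (partialDeriv i φ) :=
  (hφ.continuous_fderiv (by simp)).clm_apply continuous_const

/-- Integration by parts for the approximating smooth functions passes to the limit, so a function
with a trace has the weak derivatives used in the definition of the trace. -/
theorem HasTrace.isW12 (h : HasTrace Ω f Df g)
    (hf : MemLp f 2 (volume.restrict Ω)) (hDf : ∀ i, MemLp (Df i) 2 (volume.restrict Ω)) :
    IsW12 Ω f Df := by
  refine ⟨hf, hDf, fun i φ hφ hφc hφΩ => ?_⟩
  obtain ⟨-, u, hu, hu1, hu2, -⟩ := h
  have hcφ : Continuous (partialDeriv i φ) := continuous_partialDeriv hφ i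
  have hsupp : ∀ x, x ∉ tsupport φ → partialDeriv i φ x = 0 := by
    intro x hx
    have : x ∉ tsupport (fderiv ℝ φ) := fun h => hx (tsupport_fderiv_subset ℝ h)
    simp [partialDeriv, image_eq_zero_of_notMem_tsupport this]
  have hcφ' : HasCompactSupport (partialDeriv i φ) := HasCompactSupport.intro hφc hsupp
  have hm1 : MemLp φ 2 (volume.restrict Ω) :=
    (hφ.continuous.memLp_of_hasCompactSupport hφc).restrict _
  have hm2 : MemLp (partialDeriv i φ) 2 (volume.restrict Ω) :=
    (hcφ.memLp_of_hasCompactSupport hcφ').restrict _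
  have l1 := tendsto_integral_smul_of_tendsto_eLpNorm_two hm2 hf
    (fun m => (hu m).continuous.aestronglyMeasurable) hu1
  have l2 := tendsto_integral_smul_of_tendsto_eLpNorm_two hm1 (hDf i)
    (fun m => (continuous_partialDeriv (hu m) i).aestronglyMeasurable) (hu2 i)
  refine tendsto_nhds_unique l1 (l2.neg.congr fun m => ?_)
  rw [setIntegral_eq_integral_of_forall_compl_eq_zero (s := Ω),
    setIntegral_eq_integral_of_forall_compl_eq_zero (s := Ω)]
  · have hd := integral_smul_fderiv_eq_neg_fderiv_smul_of_integrable (𝕜 := ℝ)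
      (μ := (volume : Measure (EuclideanSpace ℝ (Fin n))))
      (f := φ) (g := u m) (v := EuclideanSpace.single i 1) ?_ ?_ ?_ ?_ ?_
    · simp only [partialDeriv]
      rw [hd, neg_neg]
    · exact ((hcφ.smul (hu m).continuous).integrable_of_hasCompactSupport hcφ'.smul_right)
    · exact ((hφ.continuous.smul
        (continuous_partialDeriv (hu m) i)).integrable_of_hasCompactSupport hφc.smul_right)
    · exact ((hφ.continuous.smul (hu m).continuous).integrable_of_hasCompactSupport hφc.smul_right)
    · exact fun x _ => (hφ.differentiable (by simp)) x
    · exact fun x _ => ((hu m).differentiable (by simp)) x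
  · intro x hx
    rw [hsupp x fun h => hx (hφΩ h), zero_smul]
  · intro x hx
    rw [image_eq_zero_of_notMem_tsupport fun h => hx (hφΩ h), zero_smul]

/-- The graph of the trace operator is closed. -/
theorem HasTrace.of_tendsto {fs : ℕ → EuclideanSpace ℝ (Fin n) → F}
    {Dfs : ℕ → Fin n → EuclideanSpace ℝ (Fin n) → F} {gs : ℕ → EuclideanSpace ℝ (Fin n) → F}
    (h : ∀ m, HasTrace Ω (fs m) (Dfs m) (gs m))
    (hfs : ∀ m, AEStronglyMeasurable (fs m) (volume.restrict Ω))
    (hf : AEStronglyMeasurable f (volume.restrict Ω))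
    (hDfs : ∀ m i, AEStronglyMeasurable (Dfs m i) (volume.restrict Ω))
    (hDf : ∀ i, AEStronglyMeasurable (Df i) (volume.restrict Ω))
    (hg : AEStronglyMeasurable g (surfaceMeasure Ω))
    (h1 : Tendsto (fun m => eLpNorm (fs m - f) 2 (volume.restrict Ω)) atTop (𝓝 0))
    (h2 : ∀ i, Tendsto (fun m => eLpNorm (Dfs m i - Df i) 2 (volume.restrict Ω)) atTop (𝓝 0))
    (h3 : Tendsto (fun m => eLpNorm (gs m - g) 2 (surfaceMeasure Ω)) atTop (𝓝 0)) :
    HasTrace Ω f Df g := by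
  refine ⟨memLp_of_tendsto_eLpNorm (fun m => (h m).1) hg h3, ?_⟩
  have tri : ∀ {μ : Measure (EuclideanSpace ℝ (Fin n))} {a b c : EuclideanSpace ℝ (Fin n) → F},
      AEStronglyMeasurable a μ → AEStronglyMeasurable b μ → AEStronglyMeasurable c μ →
      eLpNorm (a - c) 2 μ ≤ eLpNorm (a - b) 2 μ + eLpNorm (b - c) 2 μ := by
    intro μ a b c ha hb hc
    have := eLpNorm_add_le (ha.sub hb) (hb.sub hc) (p := 2) (by norm_num)
    simpa using this
  have key : ∀ m : ℕ, ∃ φ : EuclideanSpace ℝ (Fin n) → F, ContDiff ℝ ∞ φ ∧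
      eLpNorm (φ - fs m) 2 (volume.restrict Ω) ≤ ((m : ℝ≥0∞) + 1)⁻¹ ∧
      (∀ i, eLpNorm (partialDeriv i φ - Dfs m i) 2 (volume.restrict Ω) ≤ ((m : ℝ≥0∞) + 1)⁻¹) ∧
      eLpNorm (φ - gs m) 2 (surfaceMeasure Ω) ≤ ((m : ℝ≥0∞) + 1)⁻¹ := by
    intro m
    obtain ⟨-, u, hu, hu1, hu2, hu3⟩ := h m
    have hpos : (0 : ℝ≥0∞) < ((m : ℝ≥0∞) + 1)⁻¹ := by
      simp [ENNReal.inv_pos]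
    have e2 := eventually_all.2 fun i => (hu2 i).eventually (ge_mem_nhds hpos)
    obtain ⟨j, hj1, hj2, hj3⟩ := ((hu1.eventually (ge_mem_nhds hpos)).and
      (e2.and (hu3.eventually (ge_mem_nhds hpos)))).exists
    exact ⟨u j, hu j, hj1, hj2, hj3⟩
  choose φ hφ hφ1 hφ2 hφ3 using key
  have hlim : Tendsto (fun m : ℕ => ((m : ℝ≥0∞) + 1)⁻¹) atTop (𝓝 0) := by
    have := (tendsto_add_atTop_iff_nat 1).2 ENNReal.tendsto_inv_nat_nhds_zero
    simpa using this
  have sq : ∀ {a b : ℕ → ℝ≥0∞}, Tendsto b atTop (𝓝 0) →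
      (∀ m, a m ≤ ((m : ℝ≥0∞) + 1)⁻¹ + b m) → Tendsto a atTop (𝓝 0) := by
    intro a b hb hab
    refine tendsto_of_tendsto_of_tendsto_of_le_of_le tendsto_const_nhds ?_ (fun _ => zero_le) hab
    simpa using hlim.add hb
  refine ⟨φ, hφ, sq h1 fun m => ?_, fun i => sq (h2 i) fun m => ?_, sq h3 fun m => ?_⟩
  · exact (tri (hφ m).continuous.aestronglyMeasurable (hfs m) hf).trans
      (add_le_add_left (hφ1 m) _)
  · exact (tri (continuous_partialDeriv (hφ m) i).aestronglyMeasurable (hDfs m i) (hDf i)).trans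
      (add_le_add_left (hφ2 m i) _)
  · exact (tri (hφ m).continuous.aestronglyMeasurable (h m).1.1 hg).trans
      (add_le_add_left (hφ3 m) _)

end Trace

/-! ### Chain rule for traces -/

section ChainRule

variable {n : ℕ} {V W : Type*} [NormedAddCommGroup V] [NormedSpace ℝ V]
  [NormedAddCommGroup W] [NormedSpace ℝ W]
  {Ω : Set (EuclideanSpace ℝ (Fin n))} {v : EuclideanSpace ℝ (Fin n) → V}
  {Dv : Fin n → EuclideanSpace ℝ (Fin n) → V} {g : EuclideanSpace ℝ (Fin n) → V}
  {u : EuclideanSpace ℝ (Fin n) → W} {Du : Fin n → EuclideanSpace ℝ (Fin n) → W}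
  {G : EuclideanSpace ℝ (Fin n) → W}

theorem HasTrace.congr {g' : EuclideanSpace ℝ (Fin n) → V} (h : HasTrace Ω v Dv g)
    (hg : g =ᵐ[surfaceMeasure Ω] g') : HasTrace Ω v Dv g' := by
  obtain ⟨hm, φ, h0, h1, h2, h3⟩ := h
  refine ⟨hm.ae_eq hg, φ, h0, h1, h2, h3.congr fun m => eLpNorm_congr_ae ?_⟩
  filter_upwards [hg] with x hx
  simp [hx]

theorem aestronglyMeasurable_fderiv_comp_apply {α : Type*} [MeasurableSpace α] {μ : Measure α}
    {a b : α → V} (ha : AEStronglyMeasurable a μ) (hb : AEStronglyMeasurable b μ) {Φ : V → W}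
    (hΦ : ContDiff ℝ ∞ Φ) : AEStronglyMeasurable (fun x => fderiv ℝ Φ (a x) (b x)) μ := by
  have : Continuous fun q : V × V => fderiv ℝ Φ q.1 q.2 :=
    ((hΦ.continuous_fderiv (by simp)).comp continuous_fst).clm_apply continuous_snd
  exact this.comp_aestronglyMeasurable (ha.prodMk hb)

theorem aestronglyMeasurable_fderiv_fderiv_comp_apply {α : Type*} [MeasurableSpace α]
    {μ : Measure α} {a b c : α → V} (ha : AEStronglyMeasurable a μ)
    (hb : AEStronglyMeasurable b μ) (hc : AEStronglyMeasurable c μ) {Φ : V → W}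
    (hΦ : ContDiff ℝ ∞ Φ) :
    AEStronglyMeasurable (fun x => fderiv ℝ (fderiv ℝ Φ) (a x) (b x) (c x)) μ := by
  have hΦ' : ContDiff ℝ ∞ (fderiv ℝ Φ) := hΦ.fderiv_right (by simp)
  have : Continuous fun q : V × V × V => fderiv ℝ (fderiv ℝ Φ) q.1 q.2.1 q.2.2 :=
    (((hΦ'.continuous_fderiv (by simp)).comp continuous_fst).clm_apply
      (continuous_fst.comp continuous_snd)).clm_apply (continuous_snd.comp continuous_snd)
  exact this.comp_aestronglyMeasurable (ha.prodMk (hb.prodMk hc))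

omit [NormedSpace ℝ V] in
theorem memLp_two_norm_mul_norm {α : Type*} [MeasurableSpace α] {μ : Measure α}
    {a b : α → V} (ha : MemLp a 4 μ) (hb : MemLp b 4 μ) :
    MemLp (fun x => ‖a x‖ * ‖b x‖) 2 μ := by
  have : ENNReal.HolderTriple 4 4 2 := ⟨by
    rw [← two_mul, show (4 : ℝ≥0∞) = 2 * 2 by norm_num, ENNReal.mul_inv (by simp) (by simp),
      ← mul_assoc, ENNReal.mul_inv_cancel (by simp) (by simp), one_mul]⟩
  exact hb.norm.mul ha.norm

theorem tendsto_eLpNorm_of_le_const_mul {α : Type*} [MeasurableSpace α] {μ : Measure α}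
    {F F' : Type*} [NormedAddCommGroup F] [NormedAddCommGroup F'] {a : ℕ → α → F}
    {b : ℕ → α → F'} {p : ℝ≥0∞} (K : ℝ) (h : ∀ m x, ‖a m x‖ ≤ K * ‖b m x‖)
    (hb : Tendsto (fun m => eLpNorm (b m) p μ) atTop (𝓝 0)) :
    Tendsto (fun m => eLpNorm (a m) p μ) atTop (𝓝 0) := by
  have : Tendsto (fun m => ENNReal.ofReal K * eLpNorm (b m) p μ) atTop (𝓝 0) := by
    simpa using ENNReal.Tendsto.const_mul hb (Or.inr (ENNReal.ofReal_ne_top (r := K)))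
  exact tendsto_of_tendsto_of_tendsto_of_le_of_le tendsto_const_nhds this (fun _ => zero_le)
    fun m => eLpNorm_le_mul_eLpNorm_of_ae_le_mul (Eventually.of_forall (h m)) p

theorem tendsto_eLpNorm_add {α : Type*} [MeasurableSpace α] {μ : Measure α}
    {F : Type*} [NormedAddCommGroup F] {a b : ℕ → α → F}
    (ha' : ∀ m, AEStronglyMeasurable (a m) μ) (hb' : ∀ m, AEStronglyMeasurable (b m) μ)
    (ha : Tendsto (fun m => eLpNorm (a m) 2 μ) atTop (𝓝 0))
    (hb : Tendsto (fun m => eLpNorm (b m) 2 μ) atTop (𝓝 0)) :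
    Tendsto (fun m => eLpNorm (a m + b m) 2 μ) atTop (𝓝 0) :=
  tendsto_of_tendsto_of_tendsto_of_le_of_le tendsto_const_nhds (by simpa using ha.add hb)
    (fun _ => zero_le) fun m => eLpNorm_add_le (ha' m) (hb' m) (by norm_num)

/-- Chain rule for a smooth map with bounded differential: composing the approximating smooth
functions with the map gives, along a subsequence, approximations of the composition. -/
theorem HasTrace.comp (h : HasTrace Ω v Dv g) (hv : AEStronglyMeasurable v (volume.restrict Ω))
    (hDv : ∀ i, MemLp (Dv i) 2 (volume.restrict Ω)) {Φ : V → W} (hΦ : ContDiff ℝ ∞ Φ) {K : ℝ}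
    (hK : ∀ y, ‖fderiv ℝ Φ y‖ ≤ K) (hg : MemLp (fun x => Φ (g x)) 2 (surfaceMeasure Ω)) :
    HasTrace Ω (fun x => Φ (v x)) (fun i x => fderiv ℝ Φ (v x) (Dv i x)) (fun x => Φ (g x)) := by
  obtain ⟨-, φ, hφ, hφ1, hφ2, hφ3⟩ := h
  obtain ⟨ns, hns, hae⟩ := (tendstoInMeasure_of_tendsto_eLpNorm (by norm_num)
    (fun m => (hφ m).continuous.aestronglyMeasurable) hv hφ1).exists_seq_tendsto_ae
  have hns' := hns.tendsto_atTop
  have lip : ∀ a b, ‖Φ a - Φ b‖ ≤ K * ‖a - b‖ := fun a b =>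
    convex_univ.norm_image_sub_le_of_norm_fderiv_le
      (fun x _ => (hΦ.differentiable (by simp)) x) (fun x _ => hK x) (mem_univ b) (mem_univ a)
  refine ⟨hg, fun m x => Φ (φ (ns m) x), fun m => hΦ.comp (hφ _), ?_, fun i => ?_, ?_⟩
  · exact tendsto_eLpNorm_of_le_const_mul K (fun m x => lip _ _) (hφ1.comp hns')
  · have hA : ∀ m, AEStronglyMeasurable
        (fun x => fderiv ℝ Φ (φ (ns m) x) (partialDeriv i (φ (ns m)) x - Dv i x))
        (volume.restrict Ω) := fun m =>
      aestronglyMeasurable_fderiv_comp_apply (hφ _).continuous.aestronglyMeasurable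
        ((continuous_partialDeriv (hφ _) i).aestronglyMeasurable.sub (hDv i).1) hΦ
    have hB : ∀ m, AEStronglyMeasurable (fun x => fderiv ℝ Φ (φ (ns m) x) (Dv i x))
        (volume.restrict Ω) := fun m =>
      aestronglyMeasurable_fderiv_comp_apply (hφ _).continuous.aestronglyMeasurable (hDv i).1 hΦ
    have t1 : Tendsto (fun m => eLpNorm
        (fun x => fderiv ℝ Φ (φ (ns m) x) (partialDeriv i (φ (ns m)) x - Dv i x)) 2
        (volume.restrict Ω)) atTop (𝓝 0) :=
      tendsto_eLpNorm_of_le_const_mul K (fun m x => (ContinuousLinearMap.le_opNorm _ _).trans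
        (mul_le_mul_of_nonneg_right (hK _) (norm_nonneg _))) ((hφ2 i).comp hns')
    have t2 := (tendsto_eLpNorm_two_of_dominated hB ((hDv i).norm.const_mul K)
      (f₀ := fun x => fderiv ℝ Φ (v x) (Dv i x))
      (fun m => Eventually.of_forall fun x => (ContinuousLinearMap.le_opNorm _ _).trans
        (mul_le_mul_of_nonneg_right (hK _) (norm_nonneg _))) ?_).2
    · refine (tendsto_eLpNorm_add hA (fun m => (hB m).sub
        (aestronglyMeasurable_fderiv_comp_apply hv (hDv i).1 hΦ)) t1 t2).congr fun m => ?_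
      congr 1
      ext x
      have : partialDeriv i (fun x => Φ (φ (ns m) x)) x
          = fderiv ℝ Φ (φ (ns m) x) (partialDeriv i (φ (ns m)) x) := by
        unfold partialDeriv
        rw [show (fun x => Φ (φ (ns m) x)) = Φ ∘ φ (ns m) from rfl,
          fderiv_comp _ ((hΦ.differentiable (by simp)) _) (((hφ _).differentiable (by simp)) _)]
        rfl
      simp [this]
    · filter_upwards [hae] with x hx
      have : Continuous fun y => fderiv ℝ Φ y (Dv i x) :=
        (hΦ.continuous_fderiv (by simp)).clm_apply continuous_const
      exact (this.tendsto _).comp hx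
  · exact tendsto_eLpNorm_of_le_const_mul K (fun m x => lip _ _) (hφ3.comp hns')

theorem HasTrace.prodMk (h : HasTrace Ω v Dv g) (h' : HasTrace Ω u Du G)
    (hv : AEStronglyMeasurable v (volume.restrict Ω))
    (hDv : ∀ i, AEStronglyMeasurable (Dv i) (volume.restrict Ω))
    (hu : AEStronglyMeasurable u (volume.restrict Ω))
    (hDu : ∀ i, AEStronglyMeasurable (Du i) (volume.restrict Ω)) :
    HasTrace Ω (fun x => (v x, u x)) (fun i x => (Dv i x, Du i x)) (fun x => (g x, G x)) := by
  obtain ⟨hg, φ, hφ, hφ1, hφ2, hφ3⟩ := h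
  obtain ⟨hG, ψ, hψ, hψ1, hψ2, hψ3⟩ := h'
  have key : ∀ {μ : Measure (EuclideanSpace ℝ (Fin n))} {a : ℕ → EuclideanSpace ℝ (Fin n) → V}
      {b : ℕ → EuclideanSpace ℝ (Fin n) → W}, (∀ m, AEStronglyMeasurable (a m) μ) →
      (∀ m, AEStronglyMeasurable (b m) μ) → Tendsto (fun m => eLpNorm (a m) 2 μ) atTop (𝓝 0) →
      Tendsto (fun m => eLpNorm (b m) 2 μ) atTop (𝓝 0) →
      Tendsto (fun m => eLpNorm (fun x => (a m x, b m x)) 2 μ) atTop (𝓝 0) := by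
    intro μ a b ha hb ta tb
    have h1 : Tendsto (fun m => eLpNorm (fun x => (a m x, (0 : W))) 2 μ) atTop (𝓝 0) :=
      tendsto_eLpNorm_of_le_const_mul 1 (fun m x => by simp) ta
    have h2 : Tendsto (fun m => eLpNorm (fun x => ((0 : V), b m x)) 2 μ) atTop (𝓝 0) :=
      tendsto_eLpNorm_of_le_const_mul 1 (fun m x => by simp) tb
    refine (tendsto_eLpNorm_add (fun m => (ha m).prodMk aestronglyMeasurable_const)
      (fun m => aestronglyMeasurable_const.prodMk (hb m)) h1 h2).congr fun m => ?_
    congr 1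
    ext x <;> simp
  refine ⟨memLp_prod_iff.2 ⟨hg, hG⟩, fun m x => (φ m x, ψ m x), fun m => (hφ m).prodMk (hψ m),
    ?_, fun i => ?_, ?_⟩
  · exact key (fun m => (hφ m).continuous.aestronglyMeasurable.sub hv)
      (fun m => (hψ m).continuous.aestronglyMeasurable.sub hu) hφ1 hψ1
  · have e : ∀ m, partialDeriv i (fun x => (φ m x, ψ m x))
        = fun x => (partialDeriv i (φ m) x, partialDeriv i (ψ m) x) := by
      intro m
      ext1 x
      unfold partialDeriv
      have := ((((hφ m).differentiable (by simp)) x).hasFDerivAt.prodMk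
        (((hψ m).differentiable (by simp)) x).hasFDerivAt).fderiv
      rw [this]
      rfl
    simp only [e]
    exact key (fun m => (continuous_partialDeriv (hφ m) i).aestronglyMeasurable.sub (hDv i))
      (fun m => (continuous_partialDeriv (hψ m) i).aestronglyMeasurable.sub (hDu i))
      (hφ2 i) (hψ2 i)
  · exact key (fun m => (hφ m).continuous.aestronglyMeasurable.sub hg.1)
      (fun m => (hψ m).continuous.aestronglyMeasurable.sub hG.1) hφ3 hψ3

end ChainRule

/-! ### Product rule for traces -/

section ProductRule

variable {n : ℕ} {V W : Type*} [NormedAddCommGroup V] [InnerProductSpace ℝ V]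
  [FiniteDimensional ℝ V] [NormedAddCommGroup W] [NormedSpace ℝ W]
  {Ω : Set (EuclideanSpace ℝ (Fin n))} {v : EuclideanSpace ℝ (Fin n) → V}
  {Dv : Fin n → EuclideanSpace ℝ (Fin n) → V} {g : EuclideanSpace ℝ (Fin n) → V}
  {u : EuclideanSpace ℝ (Fin n) → V} {Du : Fin n → EuclideanSpace ℝ (Fin n) → V}
  {G : EuclideanSpace ℝ (Fin n) → V}

variable (V) in
/-- Smooth bounded truncations which exhaust the identity, with uniformly bounded differentials. -/
theorem exists_truncation : ∃ (L : ℝ) (T : ℕ → V → V), ∀ m, ContDiff ℝ ∞ (T m) ∧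
    (∃ B, ∀ y, ‖T m y‖ ≤ B) ∧ (∀ y, ‖T m y‖ ≤ ‖y‖) ∧ (∀ y, ‖fderiv ℝ (T m) y‖ ≤ L) ∧
    ∀ y, ‖y‖ < m + 1 → T m =ᶠ[𝓝 y] id := by
  let χ : ContDiffBump (0 : V) := ⟨1, 2, one_pos, one_lt_two⟩
  let S : V → V := fun y => χ y • y
  have hS : ContDiff ℝ ∞ S := χ.contDiff.smul contDiff_id
  have hSc : HasCompactSupport S := χ.hasCompactSupport.smul_right
  obtain ⟨B, hB⟩ := hS.continuous.bounded_above_of_compact_support hSc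
  obtain ⟨L, hL⟩ := (hS.continuous_fderiv (by simp)).bounded_above_of_compact_support
    (hSc.fderiv ℝ)
  refine ⟨L, fun m y => ((m : ℝ) + 1) • S (((m : ℝ) + 1)⁻¹ • y), fun m => ?_⟩
  beta_reduce
  have hc : (0 : ℝ) < (m : ℝ) + 1 := by positivity
  generalize (m : ℝ) + 1 = c at hc
  have hd : ∀ y, HasFDerivAt (fun y => c • S (c⁻¹ • y)) (fderiv ℝ S (c⁻¹ • y)) y := by
    intro y
    have h1 := (((hS.differentiable (by simp)) (c⁻¹ • y)).hasFDerivAt.comp y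
      ((hasFDerivAt_id y).const_smul c⁻¹)).const_smul c
    refine h1.congr_fderiv ?_
    ext z
    simp [smul_smul, hc.ne']
  refine ⟨?_, ⟨c * B, fun y => ?_⟩, fun y => ?_, fun y => ?_, fun y hy => ?_⟩
  · exact (hS.comp (contDiff_id.const_smul c⁻¹)).const_smul c
  · rw [norm_smul, Real.norm_of_nonneg hc.le]
    exact mul_le_mul_of_nonneg_left (hB _) hc.le
  · rw [norm_smul, Real.norm_of_nonneg hc.le]
    calc c * ‖S (c⁻¹ • y)‖ ≤ c * ‖c⁻¹ • y‖ := by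
          refine mul_le_mul_of_nonneg_left ?_ hc.le
          simp only [S]
          rw [norm_smul, Real.norm_of_nonneg χ.nonneg]
          exact mul_le_of_le_one_left (norm_nonneg _) χ.le_one
      _ = ‖y‖ := by
          rw [norm_smul, norm_inv, Real.norm_of_nonneg hc.le, mul_inv_cancel_left₀ hc.ne']
  · rw [(hd y).fderiv]
    exact hL _
  · have : ∀ᶠ z in 𝓝 y, ‖z‖ < c := continuous_norm.continuousAt.eventually_lt_const hy
    filter_upwards [this] with z hz
    have : χ (c⁻¹ • z) = 1 := by
      refine χ.one_of_mem_closedBall ?_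
      rw [mem_closedBall_zero_iff, norm_smul, norm_inv, Real.norm_of_nonneg hc.le]
      change c⁻¹ * ‖z‖ ≤ 1
      rw [inv_mul_le_iff₀ hc]
      linarith
    simp [S, this, smul_smul, hc.ne']

/-- Product rule for `DΦ(v) u`, where `u` and `Dv` are in `L⁴`. Replacing `u` by a bounded
truncation gives the smooth function `(y, z) ↦ DΦ(y) (T z)` of `(v, u)`, whose differential is
bounded; the truncation is removed by dominated convergence. -/
theorem HasTrace.fderiv_comp_apply (h : HasTrace Ω v Dv g) (h' : HasTrace Ω u Du G)
    (hv : AEStronglyMeasurable v (volume.restrict Ω))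
    (hDv : ∀ i, MemLp (Dv i) 2 (volume.restrict Ω))
    (hu : MemLp u 2 (volume.restrict Ω))
    (hDu : ∀ i, MemLp (Du i) 2 (volume.restrict Ω))
    (hDv4 : ∀ i, MemLp (Dv i) 4 (volume.restrict Ω))
    (hu4 : MemLp u 4 (volume.restrict Ω))
    {Φ : V → W} (hΦ : ContDiff ℝ ∞ Φ) {K₁ K₂ : ℝ} (hK₁ : ∀ y, ‖fderiv ℝ Φ y‖ ≤ K₁)
    (hK₂ : ∀ y, ‖fderiv ℝ (fderiv ℝ Φ) y‖ ≤ K₂) :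
    HasTrace Ω (fun x => fderiv ℝ Φ (v x) (u x))
      (fun i x => fderiv ℝ (fderiv ℝ Φ) (v x) (Dv i x) (u x) + fderiv ℝ Φ (v x) (Du i x))
      (fun x => fderiv ℝ Φ (g x) (G x)) := by
  obtain ⟨L, T, hT⟩ := exists_truncation V
  have hK₁0 : 0 ≤ K₁ := (norm_nonneg _).trans (hK₁ 0)
  have hK₂0 : 0 ≤ K₂ := (norm_nonneg (fderiv ℝ (fderiv ℝ Φ) 0)).trans (hK₂ 0)
  have hL0 : 0 ≤ L := (norm_nonneg _).trans ((hT 0).2.2.2.1 0)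
  have hΦ' : ContDiff ℝ ∞ (fderiv ℝ Φ) := hΦ.fderiv_right (by simp)
  have hpair := h.prodMk h' hv (fun i => (hDv i).1) hu.1 (fun i => (hDu i).1)
  have hevt : ∀ y : V, ∀ᶠ m in atTop, T m =ᶠ[𝓝 y] id := by
    intro y
    obtain ⟨N, hN⟩ := exists_nat_gt ‖y‖
    filter_upwards [eventually_ge_atTop N] with m hm
    refine (hT m).2.2.2.2 y (hN.trans_le ?_)
    have : (N : ℝ) ≤ m := by exact_mod_cast hm
    linarith
  have hev : ∀ y : V, ∀ᶠ m in atTop, T m y = y := fun y => (hevt y).mono fun m hm => hm.eq_of_nhds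
  have hevd : ∀ y : V, ∀ᶠ m in atTop, fderiv ℝ (T m) y = ContinuousLinearMap.id ℝ V :=
    fun y => (hevt y).mono fun m hm => by rw [hm.fderiv_eq, fderiv_id]
  have hsq : ∀ i, MemLp (fun x => ‖Dv i x‖ * ‖u x‖) 2 (volume.restrict Ω) := fun i =>
    memLp_two_norm_mul_norm (hDv4 i) hu4
  have bd : ∀ y z, ‖fderiv ℝ Φ y z‖ ≤ K₁ * ‖z‖ := fun y z =>
    (ContinuousLinearMap.le_opNorm _ _).trans (mul_le_mul_of_nonneg_right (hK₁ _) (norm_nonneg _))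
  have bd2 : ∀ y z z', ‖fderiv ℝ (fderiv ℝ Φ) y z z'‖ ≤ K₂ * (‖z‖ * ‖z'‖) := fun y z z' => by
    rw [← mul_assoc]
    refine (ContinuousLinearMap.le_opNorm₂ _ _ _).trans ?_
    gcongr
    exact hK₂ _
  have bdT : ∀ m y z, ‖fderiv ℝ (T m) y z‖ ≤ L * ‖z‖ := fun m y z =>
    (ContinuousLinearMap.le_opNorm _ _).trans
      (mul_le_mul_of_nonneg_right ((hT m).2.2.2.1 _) (norm_nonneg _))
  -- the truncated product is a smooth function of the pair `(v, u)`
  have hH : ∀ m, ContDiff ℝ ∞ (fun q : V × V => fderiv ℝ Φ q.1 (T m q.2)) := fun m =>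
    (hΦ'.comp contDiff_fst).clm_apply ((hT m).1.comp contDiff_snd)
  have hH' : ∀ m (q p : V × V), fderiv ℝ (fun q : V × V => fderiv ℝ Φ q.1 (T m q.2)) q p
      = fderiv ℝ (fderiv ℝ Φ) q.1 p.1 (T m q.2) + fderiv ℝ Φ q.1 (fderiv ℝ (T m) q.2 p.2) := by
    intro m q p
    have h1 : HasFDerivAt (fun q : V × V => fderiv ℝ Φ q.1) _ q :=
      ((hΦ'.differentiable (by simp)) q.1).hasFDerivAt.comp q hasFDerivAt_fst
    have h2 : HasFDerivAt (fun q : V × V => T m q.2) _ q :=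
      (((hT m).1.differentiable (by simp)) q.2).hasFDerivAt.comp q hasFDerivAt_snd
    rw [(h1.clm_apply h2).fderiv]
    simp [add_comm]
  have hstep : ∀ m, HasTrace Ω (fun x => fderiv ℝ Φ (v x) (T m (u x)))
      (fun i x => fderiv ℝ (fderiv ℝ Φ) (v x) (Dv i x) (T m (u x))
        + fderiv ℝ Φ (v x) (fderiv ℝ (T m) (u x) (Du i x)))
      (fun x => fderiv ℝ Φ (g x) (T m (G x))) := by
    intro m
    obtain ⟨B, hB⟩ := (hT m).2.1
    have hB0 : 0 ≤ B := (norm_nonneg _).trans (hB 0)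
    have := hpair.comp (hv.prodMk hu.1) (fun i => memLp_prod_iff.2 ⟨hDv i, hDu i⟩) (hH m)
      (K := K₂ * B + K₁ * L) ?_ ?_
    · simpa only [hH'] using this
    · intro q
      refine ContinuousLinearMap.opNorm_le_bound _ (by positivity) fun p => ?_
      rw [hH', add_mul]
      refine (norm_add_le _ _).trans (add_le_add ((bd2 _ _ _).trans ?_) ((bd _ _).trans ?_))
      · rw [mul_assoc, mul_comm B]
        gcongr
        · exact norm_fst_le p
        · exact hB _
      · rw [mul_assoc]
        gcongr
        refine (bdT _ _ _).trans ?_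
        gcongr
        exact norm_snd_le p
    · refine h'.1.of_le_mul (c := K₁) ?_ (Eventually.of_forall fun x => (bd _ _).trans ?_)
      · exact aestronglyMeasurable_fderiv_comp_apply h.1.1
          ((hT m).1.continuous.comp_aestronglyMeasurable h'.1.1) hΦ
      · gcongr
        exact (hT m).2.2.1 _
  have m1 : ∀ m, AEStronglyMeasurable (fun x => fderiv ℝ Φ (v x) (T m (u x)))
      (volume.restrict Ω) := fun m => aestronglyMeasurable_fderiv_comp_apply hv
        ((hT m).1.continuous.comp_aestronglyMeasurable hu.1) hΦ
  have m2 : ∀ m i, AEStronglyMeasurable (fun x => fderiv ℝ (fderiv ℝ Φ) (v x) (Dv i x) (T m (u x))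
        + fderiv ℝ Φ (v x) (fderiv ℝ (T m) (u x) (Du i x))) (volume.restrict Ω) := fun m i => by
    have := (aestronglyMeasurable_fderiv_comp_apply (hv.prodMk hu.1)
      ((hDv i).1.prodMk (hDu i).1) (hH m))
    simpa only [hH'] using this
  have t1 := tendsto_eLpNorm_two_of_dominated m1 (hu.norm.const_mul K₁)
    (f₀ := fun x => fderiv ℝ Φ (v x) (u x))
    (fun m => Eventually.of_forall fun x => (bd _ _).trans <| by
      gcongr
      exact (hT m).2.2.1 _) <| Eventually.of_forall fun x =>
        tendsto_const_nhds.congr' <| (hev (u x)).mono fun m hm => by simp only [hm]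
  have b2 : ∀ m i x, ‖fderiv ℝ (fderiv ℝ Φ) (v x) (Dv i x) (T m (u x))
        + fderiv ℝ Φ (v x) (fderiv ℝ (T m) (u x) (Du i x))‖
      ≤ K₂ * (‖Dv i x‖ * ‖u x‖) + K₁ * L * ‖Du i x‖ := fun m i x => by
    refine (norm_add_le _ _).trans (add_le_add ((bd2 _ _ _).trans ?_) ((bd _ _).trans ?_))
    · gcongr
      exact (hT m).2.2.1 _
    · rw [mul_assoc]
      gcongr
      exact bdT _ _ _
  have t2 := fun i => tendsto_eLpNorm_two_of_dominated (fun m => m2 m i)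
    (((hsq i).const_mul K₂).add ((hDu i).norm.const_mul (K₁ * L)))
    (f₀ := fun x => fderiv ℝ (fderiv ℝ Φ) (v x) (Dv i x) (u x) + fderiv ℝ Φ (v x) (Du i x))
    (fun m => Eventually.of_forall (b2 m i)) <| Eventually.of_forall fun x =>
        tendsto_const_nhds.congr' <| ((hev (u x)).and (hevd (u x))).mono fun m hm => by
          simp only [hm.1, hm.2, ContinuousLinearMap.id_apply]
  have t3 := tendsto_eLpNorm_two_of_dominated
    (fun m => (hstep m).1.1) (h'.1.norm.const_mul K₁)
    (f₀ := fun x => fderiv ℝ Φ (g x) (G x))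
    (fun m => Eventually.of_forall fun x => (bd _ _).trans <| by
      gcongr
      exact (hT m).2.2.1 _) <| Eventually.of_forall fun x =>
        tendsto_const_nhds.congr' <| (hev (G x)).mono fun m hm => by simp only [hm]
  exact HasTrace.of_tendsto hstep m1 t1.1.1 m2 (fun i => (t2 i).1.1) t3.1.1 t1.2
    (fun i => (t2 i).2) t3.2

end ProductRule

/-! ### Projection onto the sphere from an interior point -/

section RayProjection

variable {V : Type*} [NormedAddCommGroup V] [InnerProductSpace ℝ V]

/-- For `‖a‖ < 1` and `z ≠ 0`, the point where the ray from `a` in the direction `z` meets the unit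
sphere. It is `a + t z`, where `t` is the positive root of `‖a + t z‖² = 1`. The projection of `y`
onto the sphere from `a` is `rayProj a (y - a)`. -/
noncomputable def rayProj (a z : V) : V :=
  a + ((√((inner ℝ a z) ^ 2 + (1 - ‖a‖ ^ 2) * ‖z‖ ^ 2) - inner ℝ a z) / ‖z‖ ^ 2) • z

theorem norm_rayProj {a z : V} (ha : ‖a‖ < 1) (hz : z ≠ 0) : ‖rayProj a z‖ = 1 := by
  have hz' : 0 < ‖z‖ := norm_pos_iff.2 hz
  have hd : 0 ≤ (inner ℝ a z) ^ 2 + (1 - ‖a‖ ^ 2) * ‖z‖ ^ 2 := by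
    have : 0 ≤ 1 - ‖a‖ ^ 2 := by nlinarith [norm_nonneg a]
    positivity
  have hs := Real.sq_sqrt hd
  have h1 : ‖rayProj a z‖ ^ 2 = 1 := by
    unfold rayProj
    generalize √((inner ℝ a z) ^ 2 + (1 - ‖a‖ ^ 2) * ‖z‖ ^ 2) = s at hs
    rw [norm_add_sq_real, inner_smul_right, norm_smul, mul_pow, Real.norm_eq_abs, sq_abs]
    generalize inner ℝ a z = b at hs
    field_simp
    linear_combination hs
  exact (sq_eq_sq₀ (norm_nonneg _) zero_le_one).1 (by simpa using h1)

theorem rayProj_smul (a z : V) {c : ℝ} (hc : 0 < c) : rayProj a (c • z) = rayProj a z := by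
  have h1 : (inner ℝ a (c • z)) ^ 2 + (1 - ‖a‖ ^ 2) * ‖c • z‖ ^ 2
      = c ^ 2 * ((inner ℝ a z) ^ 2 + (1 - ‖a‖ ^ 2) * ‖z‖ ^ 2) := by
    rw [inner_smul_right, norm_smul, Real.norm_of_nonneg hc.le]
    ring
  unfold rayProj
  rw [h1, Real.sqrt_mul (sq_nonneg c), Real.sqrt_sq hc.le, smul_smul, inner_smul_right, norm_smul,
    Real.norm_of_nonneg hc.le]
  congr 2
  rcases eq_or_ne ‖z‖ 0 with h | h
  · simp [h]
  · field_simp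

theorem rayProj_sub_of_norm_eq_one {a y : V} (ha : ‖a‖ < 1) (hy : ‖y‖ = 1) :
    rayProj a (y - a) = y := by
  have hz : y - a ≠ 0 := by
    rw [sub_ne_zero]
    rintro rfl
    linarith
  have hz' : ‖y - a‖ ^ 2 ≠ 0 := pow_ne_zero _ (norm_ne_zero_iff.2 hz)
  have h1 : ‖y - a‖ ^ 2 = 1 - 2 * inner ℝ a y + ‖a‖ ^ 2 := by
    rw [norm_sub_sq_real, hy, real_inner_comm]
    ring
  have h2 : inner ℝ a (y - a) = inner ℝ a y - ‖a‖ ^ 2 := by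
    rw [inner_sub_right, real_inner_self_eq_norm_sq]
  have h3 : inner ℝ a y ≤ 1 := by
    have := real_inner_le_norm a y
    rw [hy] at this
    linarith
  have h4 : √((inner ℝ a (y - a)) ^ 2 + (1 - ‖a‖ ^ 2) * ‖y - a‖ ^ 2) = 1 - inner ℝ a y := by
    rw [Real.sqrt_eq_iff_eq_sq _ (by linarith)]
    · rw [h1, h2]
      ring
    · have : 0 ≤ 1 - ‖a‖ ^ 2 := by nlinarith [norm_nonneg a]
      positivity
  have h5 : (√((inner ℝ a (y - a)) ^ 2 + (1 - ‖a‖ ^ 2) * ‖y - a‖ ^ 2) - inner ℝ a (y - a))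
      / ‖y - a‖ ^ 2 = 1 := by
    rw [div_eq_one_iff_eq hz', h4, h2, h1]
    ring
  unfold rayProj
  rw [h5, one_smul, add_sub_cancel]

theorem contDiffAt_rayProj_uncurry {a z : V} (ha : ‖a‖ < 1) (hz : z ≠ 0) :
    ContDiffAt ℝ ∞ (fun q : V × V => rayProj q.1 q.2) (a, z) := by
  have hz' : 0 < ‖z‖ := norm_pos_iff.2 hz
  have hd : (inner ℝ a z) ^ 2 + (1 - ‖a‖ ^ 2) * ‖z‖ ^ 2 ≠ 0 := by
    have : 0 < 1 - ‖a‖ ^ 2 := by nlinarith [norm_nonneg a]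
    positivity
  have h1 : ContDiffAt ℝ ∞ (fun q : V × V => (inner ℝ q.1 q.2 : ℝ)) (a, z) :=
    contDiffAt_fst.inner ℝ contDiffAt_snd
  have h2 : ContDiffAt ℝ ∞ (fun q : V × V => ‖q.2‖ ^ 2) (a, z) := contDiffAt_snd.norm_sq ℝ
  have h3 : ContDiffAt ℝ ∞ (fun q : V × V => ‖q.1‖ ^ 2) (a, z) := contDiffAt_fst.norm_sq ℝ
  have h4 := ((h1.pow 2).add ((contDiffAt_const (c := (1 : ℝ))).sub h3 |>.mul h2)).sqrt hd
  exact contDiffAt_fst.add (((h4.sub h1).div h2 (by positivity)).smul contDiffAt_snd)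

theorem contDiffAt_rayProj {a z : V} (ha : ‖a‖ < 1) (hz : z ≠ 0) :
    ContDiffAt ℝ ∞ (rayProj a) z :=
  (contDiffAt_rayProj_uncurry ha hz).comp z (contDiffAt_const.prodMk contDiffAt_id)

/-- The projection fixes the sphere, so its differential fixes tangent vectors. -/
theorem fderiv_rayProj_sub_apply {a y τ : V} (ha : ‖a‖ < 1) (hy : ‖y‖ = 1)
    (hτ : inner ℝ y τ = 0) : fderiv ℝ (rayProj a) (y - a) τ = τ := by
  have hz : y - a ≠ 0 := by
    rw [sub_ne_zero]
    rintro rfl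
    linarith
  -- a curve on the sphere through `y` with velocity `τ`
  let c : ℝ → V := fun t => (√(1 + t ^ 2 * ‖τ‖ ^ 2))⁻¹ • (y + t • τ)
  have hc1 : ∀ t, ‖c t‖ = 1 := by
    intro t
    have h1 : ‖y + t • τ‖ = √(1 + t ^ 2 * ‖τ‖ ^ 2) := by
      rw [eq_comm, Real.sqrt_eq_iff_eq_sq (by positivity) (norm_nonneg _), norm_add_sq_real, hy,
        inner_smul_right, hτ, norm_smul, mul_pow, Real.norm_eq_abs, sq_abs]
      ring
    have h2 : (0 : ℝ) < √(1 + t ^ 2 * ‖τ‖ ^ 2) := by positivity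
    simp only [c]
    rw [norm_smul, h1, norm_inv, Real.norm_of_nonneg h2.le, inv_mul_cancel₀ h2.ne']
  have hc0 : c 0 = y := by simp [c]
  have hcd : HasDerivAt c τ 0 := by
    have h1 : HasDerivAt (fun t : ℝ => 1 + t ^ 2 * ‖τ‖ ^ 2) 0 0 := by
      simpa using (((hasDerivAt_id (0 : ℝ)).pow 2).mul_const (‖τ‖ ^ 2)).const_add 1
    have h2 := (h1.sqrt (by simp)).inv (by simp)
    have h3 : HasDerivAt (fun t : ℝ => y + t • τ) τ 0 := by
      simpa using ((hasDerivAt_id (0 : ℝ)).smul_const τ).const_add y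
    have h4 := h2.smul h3
    simp at h4
    exact h4
  have hP : HasFDerivAt (rayProj a) (fderiv ℝ (rayProj a) (y - a)) (c 0 - a) := by
    rw [hc0]
    exact ((contDiffAt_rayProj ha hz).differentiableAt (by simp)).hasFDerivAt
  have h4 := hP.comp_hasDerivAt (0 : ℝ) (hcd.sub_const a)
  have h5 : (rayProj a ∘ fun t => c t - a) = c := by
    ext1 t
    exact rayProj_sub_of_norm_eq_one ha (hc1 t)
  rw [h5] at h4
  exact h4.unique hcd

variable {W : Type*} [NormedAddCommGroup W] [NormedSpace ℝ W]

/-- The differential of a function which is homogeneous of degree `0` has degree `-1`. -/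
theorem fderiv_smul_of_homogeneous {f : V → W} (hf : ∀ z (c : ℝ), 0 < c → f (c • z) = f z)
    (z : V) {c : ℝ} (hc : 0 < c) : fderiv ℝ f (c • z) = c⁻¹ • fderiv ℝ f z := by
  have h1 := fderiv_comp_smul (f := f) (x := z) c
  simp only [hf _ c hc] at h1
  rw [eq_inv_smul_iff₀ hc.ne']
  exact h1.symm

set_option maxSynthPendingDepth 4 in
/-- The second differential of a function which is homogeneous of degree `0` has degree `-2`. -/
theorem fderiv_fderiv_smul_of_homogeneous {f : V → W}
    (hf : ∀ z (c : ℝ), 0 < c → f (c • z) = f z)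
    (z : V) {c : ℝ} (hc : 0 < c) :
    fderiv ℝ (fderiv ℝ f) (c • z) = (c⁻¹) ^ 2 • fderiv ℝ (fderiv ℝ f) z := by
  have h1 := fderiv_comp_smul (f := fderiv ℝ f) (x := z) c
  have h2 : (fun z => fderiv ℝ f (c • z)) = c⁻¹ • fderiv ℝ f := by
    ext1 z
    exact fderiv_smul_of_homogeneous hf z hc
  rw [h2, fderiv_const_smul_field] at h1
  rw [← inv_smul_smul₀ hc.ne' (fderiv ℝ (fderiv ℝ f) (c • z)), ← h1, Pi.smul_apply, smul_smul,
    pow_two]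

variable [FiniteDimensional ℝ V]

set_option maxSynthPendingDepth 4 in
variable (V) in
/-- The derivatives of the projection decay like homogeneous functions, uniformly in the centre:
by homogeneity it is enough to bound them for `z` in the unit sphere, which is compact. -/
theorem exists_fderiv_rayProj_bound : ∃ C : ℝ, 0 < C ∧ ∀ a z : V, ‖a‖ ≤ 1 / 2 → z ≠ 0 →
    ‖fderiv ℝ (rayProj a) z‖ ≤ C * ‖z‖⁻¹ ∧
    ‖fderiv ℝ (fderiv ℝ (rayProj a)) z‖ ≤ C * ‖z‖⁻¹ ^ 2 := by
  have hD1 : ∀ a z : V, ‖a‖ < 1 → z ≠ 0 →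
      ContDiffAt ℝ ∞ (fun q : V × V => fderiv ℝ (rayProj q.1) q.2) (a, z) := by
    intro a z ha hz
    refine ContDiffAt.fderiv (f := fun q : V × V => rayProj q.1) (n := ∞) ?_ contDiffAt_snd
      (by simp)
    exact (contDiffAt_rayProj_uncurry ha hz).comp ((a, z), z)
      ((contDiffAt_fst.comp _ contDiffAt_fst).prodMk contDiffAt_snd)
  have hD2 : ∀ a z : V, ‖a‖ < 1 → z ≠ 0 →
      ContDiffAt ℝ ∞ (fun q : V × V => fderiv ℝ (fderiv ℝ (rayProj q.1)) q.2) (a, z) := by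
    intro a z ha hz
    refine ContDiffAt.fderiv (f := fun q : V × V => fderiv ℝ (rayProj q.1)) (n := ∞) ?_
      contDiffAt_snd (by simp)
    exact (hD1 a z ha hz).comp ((a, z), z)
      ((contDiffAt_fst.comp _ contDiffAt_fst).prodMk contDiffAt_snd)
  have hK : IsCompact (Metric.closedBall (0 : V) (1 / 2) ×ˢ Metric.sphere (0 : V) 1) :=
    (isCompact_closedBall _ _).prod (isCompact_sphere _ _)
  have hmem : ∀ q ∈ Metric.closedBall (0 : V) (1 / 2) ×ˢ Metric.sphere (0 : V) 1,
      ‖q.1‖ < 1 ∧ q.2 ≠ 0 := by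
    rintro ⟨a, z⟩ ⟨ha, hz⟩
    rw [mem_closedBall_zero_iff] at ha
    rw [mem_sphere_zero_iff_norm] at hz
    exact ⟨ha.trans_lt (by norm_num), norm_ne_zero_iff.1 (by rw [hz]; exact one_ne_zero)⟩
  obtain ⟨C₁, hC₁⟩ := hK.exists_bound_of_continuousOn
    (f := fun q : V × V => fderiv ℝ (rayProj q.1) q.2)
    fun q hq => (hD1 q.1 q.2 (hmem q hq).1 (hmem q hq).2).continuousAt.continuousWithinAt
  obtain ⟨C₂, hC₂⟩ := hK.exists_bound_of_continuousOn
    (f := fun q : V × V => fderiv ℝ (fderiv ℝ (rayProj q.1)) q.2)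
    fun q hq => (hD2 q.1 q.2 (hmem q hq).1 (hmem q hq).2).continuousAt.continuousWithinAt
  refine ⟨max 1 (max C₁ C₂), by positivity, fun a z ha hz => ?_⟩
  have hz' : 0 < ‖z‖ := norm_pos_iff.2 hz
  have hq : (a, ‖z‖⁻¹ • z) ∈ Metric.closedBall (0 : V) (1 / 2) ×ˢ Metric.sphere (0 : V) 1 := by
    refine ⟨by simpa using ha, ?_⟩
    rw [mem_sphere_zero_iff_norm, norm_smul, norm_inv, norm_norm, inv_mul_cancel₀ hz'.ne']
  have hzz : z = ‖z‖ • (‖z‖⁻¹ • z) := by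
    rw [smul_smul, mul_inv_cancel₀ hz'.ne', one_smul]
  have hom : ∀ z (c : ℝ), 0 < c → rayProj a (c • z) = rayProj a z :=
    fun z c hc => rayProj_smul a z hc
  constructor
  · conv_lhs => rw [hzz, fderiv_smul_of_homogeneous hom _ hz']
    rw [norm_smul, norm_inv, norm_norm, mul_comm]
    gcongr
    exact (hC₁ _ hq).trans ((le_max_left _ _).trans (le_max_right _ _))
  · conv_lhs => rw [hzz, fderiv_fderiv_smul_of_homogeneous hom _ hz']
    rw [norm_smul, norm_pow, norm_inv, norm_norm, mul_comm]
    gcongr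
    exact (hC₂ _ hq).trans ((le_max_right _ _).trans (le_max_right _ _))

set_option maxSynthPendingDepth 4 in
/-- Smooth maps with bounded derivatives which agree with the projection from `a` away from smaller
and smaller balls about `a`, and satisfy the same derivative bounds. They are rescalings of one
map, obtained by cutting off the projection near its centre. -/
theorem exists_smooth_approx_rayProj {a : V} (ha : ‖a‖ ≤ 1 / 2) :
    ∃ (Ψ : ℕ → V → V) (C : ℝ), ∀ m, ContDiff ℝ ∞ (Ψ m) ∧
      (∃ K, ∀ y, ‖fderiv ℝ (Ψ m) y‖ ≤ K) ∧ (∃ K, ∀ y, ‖fderiv ℝ (fderiv ℝ (Ψ m)) y‖ ≤ K) ∧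
      (∀ y, ‖Ψ m y‖ ≤ 2) ∧
      (∀ y, y ≠ a → ‖fderiv ℝ (Ψ m) y‖ ≤ C * ‖y - a‖⁻¹) ∧
      (∀ y, y ≠ a → ‖fderiv ℝ (fderiv ℝ (Ψ m)) y‖ ≤ C * ‖y - a‖⁻¹ ^ 2) ∧
      (∀ y, 1 < (m + 3) * ‖y - a‖ → Ψ m =ᶠ[𝓝 y] fun y => rayProj a (y - a)) := by
  have ha1 : ‖a‖ < 1 := ha.trans_lt (by norm_num)
  obtain ⟨C, hC0, hC⟩ := exists_fderiv_rayProj_bound V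
  let χ : ContDiffBump (0 : V) := ⟨1 / 2, 1, by norm_num, by norm_num⟩
  -- the map to be rescaled: constant near `0`, equal to the projection outside the unit ball
  let R : V → V := fun z => a + (1 - χ z) • (rayProj a z - a)
  have hR1 : ∀ z, 1 < ‖z‖ → R =ᶠ[𝓝 z] rayProj a := by
    intro z hz
    filter_upwards [continuous_norm.continuousAt.eventually_const_lt hz] with w hw
    have : χ w = 0 := χ.zero_of_le_dist (by rw [dist_zero_right]; exact hw.le)
    simp [R, this]
  have hR : ContDiff ℝ ∞ R := by
    refine contDiff_iff_contDiffAt.2 fun z => ?_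
    rcases eq_or_ne z 0 with rfl | hz
    · have : R =ᶠ[𝓝 0] fun _ => a := by
        filter_upwards [χ.eventuallyEq_one] with w hw
        simp [R, hw]
      exact contDiffAt_const.congr_of_eventuallyEq this
    · exact contDiffAt_const.add ((contDiffAt_const.sub χ.contDiff.contDiffAt).smul
        ((contDiffAt_rayProj ha1 hz).sub contDiffAt_const))
  have hRb : ∀ z, ‖R z‖ ≤ 2 := by
    intro z
    rcases eq_or_ne z 0 with rfl | hz
    · have : χ (0 : V) = 1 := χ.eventuallyEq_one.eq_of_nhds
      simp only [R, this, sub_self, zero_smul, add_zero]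
      linarith
    · have e : R z = χ z • a + (1 - χ z) • rayProj a z := by
        simp only [R]
        module
      have h0 : 0 ≤ χ z := χ.nonneg
      have h1 : χ z ≤ 1 := χ.le_one
      rw [e]
      refine (norm_add_le _ _).trans ?_
      rw [norm_smul, norm_smul, norm_rayProj ha1 hz, Real.norm_of_nonneg h0,
        Real.norm_of_nonneg (by linarith)]
      nlinarith [norm_nonneg a]
  have hR' : ContDiff ℝ ∞ (fderiv ℝ R) := hR.fderiv_right (by simp)
  obtain ⟨A₁, hA₁⟩ := (isCompact_closedBall (0 : V) 1).exists_bound_of_continuousOn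
    (hR.continuous_fderiv (by simp)).continuousOn
  obtain ⟨A₂, hA₂⟩ := (isCompact_closedBall (0 : V) 1).exists_bound_of_continuousOn
    (hR'.continuous_fderiv (by simp)).continuousOn
  let A := max C (max A₁ A₂)
  have hA0 : 0 < A := hC0.trans_le (le_max_left _ _)
  have hCA : C ≤ A := le_max_left _ _
  have hA₁A : A₁ ≤ A := (le_max_left _ _).trans (le_max_right _ _)
  have hA₂A : A₂ ≤ A := (le_max_right _ _).trans (le_max_right _ _)
  have inv_le : ∀ z : V, 1 < ‖z‖ → ‖z‖⁻¹ ≤ 1 := fun z hz => inv_le_one_of_one_le₀ hz.le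
  have le_inv : ∀ z : V, z ≠ 0 → ‖z‖ ≤ 1 → 1 ≤ ‖z‖⁻¹ := fun z hz hz1 =>
    (one_le_inv₀ (norm_pos_iff.2 hz)).2 hz1
  have key1 : ∀ z, ‖fderiv ℝ R z‖ ≤ A ∧ (z ≠ 0 → ‖fderiv ℝ R z‖ ≤ A * ‖z‖⁻¹) := by
    intro z
    rcases le_or_gt ‖z‖ 1 with h | h
    · have := (hA₁ z (by simpa using h)).trans hA₁A
      exact ⟨this, fun hz => this.trans (le_mul_of_one_le_right hA0.le (le_inv z hz h))⟩
    · have hz : z ≠ 0 := by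
        rintro rfl
        simp at h
        linarith
      rw [(hR1 z h).fderiv_eq]
      have h2 : ‖fderiv ℝ (rayProj a) z‖ ≤ A * ‖z‖⁻¹ := (hC a z ha hz).1.trans (by gcongr)
      exact ⟨h2.trans (mul_le_of_le_one_right hA0.le (inv_le z h)), fun _ => h2⟩
  have key2 : ∀ z, ‖fderiv ℝ (fderiv ℝ R) z‖ ≤ A ∧
      (z ≠ 0 → ‖fderiv ℝ (fderiv ℝ R) z‖ ≤ A * ‖z‖⁻¹ ^ 2) := by
    intro z
    rcases le_or_gt ‖z‖ 1 with h | h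
    · have := (hA₂ z (by simpa using h)).trans hA₂A
      exact ⟨this, fun hz => this.trans
        (le_mul_of_one_le_right hA0.le (one_le_pow₀ (le_inv z hz h)))⟩
    · have hz : z ≠ 0 := by
        rintro rfl
        simp at h
        linarith
      rw [(hR1 z h).fderiv.fderiv_eq]
      have h2 : ‖fderiv ℝ (fderiv ℝ (rayProj a)) z‖ ≤ A * ‖z‖⁻¹ ^ 2 :=
        (hC a z ha hz).2.trans (by gcongr)
      exact ⟨h2.trans (mul_le_of_le_one_right hA0.le
        (pow_le_one₀ (by positivity) (inv_le z h))), fun _ => h2⟩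
  refine ⟨fun m y => R (((m : ℝ) + 3) • (y - a)), A, fun m => ?_⟩
  beta_reduce
  have hc : (0 : ℝ) < (m : ℝ) + 3 := by positivity
  generalize (m : ℝ) + 3 = c at hc
  have hd1 : fderiv ℝ (fun y => R (c • (y - a))) = fun y => c • fderiv ℝ R (c • (y - a)) := by
    ext1 y
    rw [fderiv_comp_sub (f := fun y => R (c • y)), fderiv_comp_smul]
  have hd2 : ∀ y, fderiv ℝ (fderiv ℝ (fun y => R (c • (y - a)))) y
      = c ^ 2 • fderiv ℝ (fderiv ℝ R) (c • (y - a)) := by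
    intro y
    rw [hd1, show (fun y => c • fderiv ℝ R (c • (y - a)))
      = c • fun y => fderiv ℝ R (c • (y - a)) from rfl, fderiv_const_smul_field, Pi.smul_apply,
      fderiv_comp_sub (f := fun y => fderiv ℝ R (c • y)), fderiv_comp_smul, smul_smul, pow_two]
  have hn : ∀ y, ‖c • (y - a)‖ = c * ‖y - a‖ := fun y => by
    rw [norm_smul, Real.norm_of_nonneg hc.le]
  have hne : ∀ y, y ≠ a → c • (y - a) ≠ 0 := fun y hy => smul_ne_zero hc.ne' (sub_ne_zero.2 hy)
  refine ⟨hR.comp ((contDiff_id.sub contDiff_const).const_smul c), ⟨c * A, fun y => ?_⟩,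
    ⟨c ^ 2 * A, fun y => ?_⟩, fun y => hRb _, fun y hy => ?_, fun y hy => ?_, fun y hy => ?_⟩
  · rw [hd1, norm_smul, Real.norm_of_nonneg hc.le]
    exact mul_le_mul_of_nonneg_left (key1 _).1 hc.le
  · rw [hd2, norm_smul, norm_pow, Real.norm_of_nonneg hc.le]
    exact mul_le_mul_of_nonneg_left (key2 _).1 (by positivity)
  · rw [hd1, norm_smul, Real.norm_of_nonneg hc.le]
    refine (mul_le_mul_of_nonneg_left ((key1 _).2 (hne y hy)) hc.le).trans_eq ?_
    rw [hn, mul_inv]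
    field_simp
  · rw [hd2, norm_smul, norm_pow, Real.norm_of_nonneg hc.le]
    refine (mul_le_mul_of_nonneg_left ((key2 _).2 (hne y hy)) (by positivity)).trans_eq ?_
    rw [hn, mul_inv]
    field_simp
  · have hcont : Tendsto (fun y => c • (y - a)) (𝓝 y) (𝓝 (c • (y - a))) :=
      (Continuous.tendsto (by fun_prop) y)
    filter_upwards [hcont.eventually (hR1 (c • (y - a)) (by rw [hn]; exact hy))] with w hw
    rw [hw, rayProj_smul a _ hc]

end RayProjection

/-! ### Averaging over the centre of projection -/

section Averaging

variable {V : Type*} [NormedAddCommGroup V] [InnerProductSpace ℝ V] [FiniteDimensional ℝ V]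
  [MeasurableSpace V] [BorelSpace V]

theorem lintegral_ball_inv_enorm_pow_lt_top {p : ℕ} (hp : p < Module.finrank ℝ V) :
    ∫⁻ z in Metric.ball (0 : V) 1, (‖z‖ₑ⁻¹) ^ p < ⊤ := by
  have : Nontrivial V := Module.nontrivial_of_finrank_pos (R := ℝ) (by omega)
  have h1 : IntegrableOn (fun y : ℝ => y ^ (Module.finrank ℝ V - 1) • (y⁻¹) ^ p) (Ioo 0 1) := by
    have h2 : IntegrableOn (fun y : ℝ => y ^ (Module.finrank ℝ V - 1 - p)) (Ioo 0 1) :=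
      ((continuous_pow _).continuousOn.integrableOn_compact isCompact_Icc).mono_set
        Ioo_subset_Icc_self
    refine h2.congr_fun (fun y hy => ?_) measurableSet_Ioo
    have hy0 : y ≠ 0 := hy.1.ne'
    dsimp only
    rw [smul_eq_mul, inv_pow, ← div_eq_mul_inv, eq_div_iff (pow_ne_zero _ hy0), ← pow_add]
    congr 1
    omega
  have h3 := (integrableOn_fun_norm_addHaar (volume : Measure V) (f := fun y => (y⁻¹) ^ p)).2 h1
  refine lt_of_le_of_lt (lintegral_mono_ae ?_) h3.2
  -- at `z = 0` the real inverse is `0`, the extended one is `⊤`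
  have h0 : ∀ᵐ z ∂(volume : Measure V), z ≠ 0 := by
    simp [ae_iff]
  filter_upwards [ae_restrict_of_ae h0] with z hz
  rw [enorm_pow, enorm_inv (norm_ne_zero_iff.2 hz), enorm_norm]

/-- The integral over centres `a` in a ball of `|y - a|⁻ᵖ` is bounded uniformly in `y`: only the
unit ball about `y` matters. -/
theorem exists_lintegral_ball_inv_enorm_sub_pow_le {p : ℕ} (hp : p < Module.finrank ℝ V) :
    ∃ c : ℝ≥0∞, c ≠ ⊤ ∧
      ∀ y : V, ∫⁻ a in Metric.ball (0 : V) (1 / 2), (‖y - a‖ₑ⁻¹) ^ p ≤ c := by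
  refine ⟨volume (Metric.ball (0 : V) (1 / 2))
    + ∫⁻ z in Metric.ball (0 : V) 1, (‖z‖ₑ⁻¹) ^ p, ?_, fun y => ?_⟩
  · exact ENNReal.add_ne_top.2 ⟨measure_ball_lt_top.ne,
      (lintegral_ball_inv_enorm_pow_lt_top hp).ne⟩
  · let F : V → ℝ≥0∞ := (Metric.ball (0 : V) 1).indicator fun z => (‖z‖ₑ⁻¹) ^ p
    have hF : ∀ z : V, (‖z‖ₑ⁻¹) ^ p ≤ 1 + F z := by
      intro z
      by_cases hz : z ∈ Metric.ball (0 : V) 1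
      · simp [F, indicator_of_mem hz]
      · refine le_trans (pow_le_one₀ zero_le (ENNReal.inv_le_one.2 ?_)) le_self_add
        have : 1 ≤ ‖z‖ := by simpa using hz
        rwa [← ofReal_norm, ENNReal.one_le_ofReal]
    calc ∫⁻ a in Metric.ball (0 : V) (1 / 2), (‖y - a‖ₑ⁻¹) ^ p
        ≤ ∫⁻ a in Metric.ball (0 : V) (1 / 2), (1 + F (y - a)) := lintegral_mono fun a => hF _
      _ = volume (Metric.ball (0 : V) (1 / 2))
          + ∫⁻ a in Metric.ball (0 : V) (1 / 2), F (y - a) := by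
          rw [lintegral_add_left measurable_const, setLIntegral_one]
      _ ≤ volume (Metric.ball (0 : V) (1 / 2)) + ∫⁻ a, F (y - a) := by
          gcongr
          exact Measure.restrict_le_self
      _ = _ := by
          rw [lintegral_sub_left_eq_self F y, lintegral_indicator Metric.isOpen_ball.measurableSet]

variable {X : Type*} [MeasurableSpace X] {μ : Measure X} {v : X → V}

theorem aemeasurable_inv_enorm_sub_pow (hv : AEStronglyMeasurable v μ) {ρ : X → ℝ≥0∞}
    (hρ : AEMeasurable ρ μ) (p : ℕ) (ν : Measure V) [SFinite ν] :
    AEMeasurable (fun q : X × V => ρ q.1 * (‖v q.1 - q.2‖ₑ⁻¹) ^ p) (μ.prod ν) := by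
  have h1 : AEMeasurable (fun q : X × V => v q.1 - q.2) (μ.prod ν) :=
    (hv.aemeasurable.comp_fst).sub measurable_snd.aemeasurable
  exact hρ.comp_fst.mul (h1.enorm.inv.pow_const p)

variable [IsFiniteMeasure μ]

theorem lintegral_lintegral_inv_enorm_sub_pow_le (hv : AEStronglyMeasurable v μ) {ρ : X → ℝ≥0∞}
    (hρ : AEMeasurable ρ μ) {p : ℕ} {c : ℝ≥0∞}
    (hc : ∀ y : V, ∫⁻ a in Metric.ball (0 : V) (1 / 2), (‖y - a‖ₑ⁻¹) ^ p ≤ c) :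
    ∫⁻ a in Metric.ball (0 : V) (1 / 2), ∫⁻ x, ρ x * (‖v x - a‖ₑ⁻¹) ^ p ∂μ
      ≤ c * ∫⁻ x, ρ x ∂μ := by
  rw [← lintegral_lintegral_swap (f := fun x a => ρ x * (‖v x - a‖ₑ⁻¹) ^ p)
    (aemeasurable_inv_enorm_sub_pow hv hρ p _), mul_comm, ← lintegral_mul_const'' _ hρ]
  refine lintegral_mono fun x => ?_
  dsimp only
  rw [lintegral_const_mul _ (by fun_prop)]
  gcongr
  exact hc _

theorem ae_lintegral_inv_enorm_sub_pow_lt_top (hv : AEStronglyMeasurable v μ) {ρ : X → ℝ≥0∞}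
    (hρ : AEMeasurable ρ μ) (hρ' : ∫⁻ x, ρ x ∂μ ≠ ⊤) {p : ℕ} (hp : p < Module.finrank ℝ V) :
    ∀ᵐ a ∂(volume.restrict (Metric.ball (0 : V) (1 / 2))),
      ∫⁻ x, ρ x * (‖v x - a‖ₑ⁻¹) ^ p ∂μ < ⊤ := by
  obtain ⟨c, hc, hcy⟩ := exists_lintegral_ball_inv_enorm_sub_pow_le hp
  refine ae_lt_top' (aemeasurable_inv_enorm_sub_pow hv hρ p _).lintegral_prod_left' ?_
  exact ne_top_of_le_ne_top (ENNReal.mul_ne_top hc hρ')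
    (lintegral_lintegral_inv_enorm_sub_pow_le hv hρ hcy)

/-- Almost every centre is avoided by `v` almost everywhere: `|v - a|⁻¹` is even integrable. -/
theorem ae_ae_ne (hv : AEStronglyMeasurable v μ) (hV : 1 < Module.finrank ℝ V) :
    ∀ᵐ a ∂(volume.restrict (Metric.ball (0 : V) (1 / 2))), ∀ᵐ x ∂μ, v x ≠ a := by
  filter_upwards [ae_lintegral_inv_enorm_sub_pow_lt_top hv (ρ := fun _ => 1)
    aemeasurable_const (by simp) hV] with a ha
  have hm : AEMeasurable (fun x => 1 * (‖v x - a‖ₑ⁻¹) ^ 1) μ := by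
    have : AEMeasurable (fun x => v x - a) μ := hv.aemeasurable.sub aemeasurable_const
    exact aemeasurable_const.mul (this.enorm.inv.pow_const 1)
  filter_upwards [ae_lt_top' hm ha.ne] with x hx hxa
  simp [hxa] at hx

/-- For almost every centre `a`, dividing an `L^p` function by `|v - a|` keeps it in `L^p`. -/
theorem ae_memLp_inv_norm_sub_smul {F : Type*} [NormedAddCommGroup F] [NormedSpace ℝ F]
    (hv : AEStronglyMeasurable v μ) {f : X → F} {p : ℕ} (hp0 : p ≠ 0)
    (hp : p < Module.finrank ℝ V) (hf : MemLp f p μ) :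
    ∀ᵐ a ∂(volume.restrict (Metric.ball (0 : V) (1 / 2))),
      MemLp (fun x => ‖v x - a‖⁻¹ • f x) p μ := by
  have hp0' : (p : ℝ≥0∞) ≠ 0 := by exact_mod_cast hp0
  have h1 := lintegral_rpow_enorm_lt_top_of_eLpNorm_lt_top hp0' (by simp) hf.eLpNorm_lt_top
  filter_upwards [ae_lintegral_inv_enorm_sub_pow_lt_top hv (hf.1.enorm.pow_const (p : ℝ))
    (by simpa using h1.ne) hp] with a ha
  have hm : AEStronglyMeasurable (fun x => ‖v x - a‖⁻¹) μ :=
    (hv.sub aestronglyMeasurable_const).norm.aemeasurable.inv.aestronglyMeasurable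
  refine ⟨hm.smul hf.1, ?_⟩
  rw [eLpNorm_lt_top_iff_lintegral_rpow_enorm_lt_top hp0' (by simp)]
  refine lt_of_le_of_lt (lintegral_mono fun x => ?_) ha
  simp only [ENNReal.toReal_natCast, ENNReal.rpow_natCast]
  rw [enorm_smul, mul_pow, mul_comm]
  gcongr
  rcases eq_or_ne (v x - a) 0 with h | h
  · simp [h]
  · rw [enorm_inv (norm_ne_zero_iff.2 h), enorm_norm]

variable (V) in
/-- Averaging over the centres: some centre is at most as bad as the average, and almost every
property of centres can be prescribed as well. -/
theorem exists_center (hV : 4 < Module.finrank ℝ V) : ∃ C : ℝ≥0∞, C ≠ ⊤ ∧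
    ∀ {X : Type} [MeasurableSpace X] (μ : Measure X) [IsFiniteMeasure μ] (v : X → V),
    AEStronglyMeasurable v μ → ∀ P Q : X → ℝ≥0∞, AEMeasurable P μ → AEMeasurable Q μ →
    ∀ good : V → Prop, (∀ᵐ a ∂(volume.restrict (Metric.ball (0 : V) (1 / 2))), good a) →
    ∃ a : V, ‖a‖ ≤ 1 / 2 ∧ good a ∧
      ∫⁻ x, (P x * (‖v x - a‖ₑ⁻¹) ^ 2 + Q x * (‖v x - a‖ₑ⁻¹) ^ 4) ∂μ
        ≤ C * ∫⁻ x, (P x + Q x) ∂μ := by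
  obtain ⟨c₂, hc₂, hc₂'⟩ := exists_lintegral_ball_inv_enorm_sub_pow_le (V := V) (p := 2)
    (by omega)
  obtain ⟨c₄, hc₄, hc₄'⟩ := exists_lintegral_ball_inv_enorm_sub_pow_le (V := V) (p := 4) hV
  set B := Metric.ball (0 : V) (1 / 2) with hB
  have hB0 : volume B ≠ 0 := (Metric.measure_ball_pos _ _ (by norm_num)).ne'
  refine ⟨(c₂ + c₄) * (volume B)⁻¹, ENNReal.mul_ne_top (ENNReal.add_ne_top.2 ⟨hc₂, hc₄⟩)
    (ENNReal.inv_ne_top.2 hB0), ?_⟩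
  intro X _ μ _ v hv P Q hP hQ good hgood
  have hfin : IsFiniteMeasure (volume.restrict B) := ⟨by
    rw [Measure.restrict_apply_univ]
    exact measure_ball_lt_top⟩
  have hmP := aemeasurable_inv_enorm_sub_pow hv hP 2 (volume.restrict B)
  have hmQ := aemeasurable_inv_enorm_sub_pow hv hQ 4 (volume.restrict B)
  have hN : ∀ᵐ a ∂(volume.restrict B), a ∈ B ∧ good a :=
    (ae_restrict_mem Metric.isOpen_ball.measurableSet).and hgood
  obtain ⟨a, ha, hle⟩ := exists_notMem_null_le_laverage
    (f := fun a => ∫⁻ x, (P x * (‖v x - a‖ₑ⁻¹) ^ 2 + Q x * (‖v x - a‖ₑ⁻¹) ^ 4) ∂μ)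
    (by simpa [Measure.restrict_eq_zero] using hB0) (hmP.add hmQ).lintegral_prod_left'
    (ae_iff.1 hN)
  have ha' : a ∈ B ∧ good a := by simpa using ha
  refine ⟨a, (mem_ball_zero_iff.1 ha'.1).le, ha'.2, hle.trans ?_⟩
  rw [laverage_eq, Measure.restrict_apply_univ, ENNReal.div_eq_inv_mul, mul_comm (c₂ + c₄),
    mul_assoc]
  gcongr
  have h1 : ∀ᵐ a ∂(volume.restrict B),
      ∫⁻ x, (P x * (‖v x - a‖ₑ⁻¹) ^ 2 + Q x * (‖v x - a‖ₑ⁻¹) ^ 4) ∂μ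
        = ∫⁻ x, P x * (‖v x - a‖ₑ⁻¹) ^ 2 ∂μ + ∫⁻ x, Q x * (‖v x - a‖ₑ⁻¹) ^ 4 ∂μ := by
    refine Eventually.of_forall fun a => lintegral_add_left' ?_ _
    have : AEMeasurable (fun x => v x - a) μ := hv.aemeasurable.sub aemeasurable_const
    exact hP.mul (this.enorm.inv.pow_const 2)
  rw [lintegral_congr_ae h1, lintegral_add_left' hmP.lintegral_prod_left', lintegral_add_left' hP,
    add_mul]
  refine add_le_add ((lintegral_lintegral_inv_enorm_sub_pow_le hv hP hc₂').trans ?_)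
    ((lintegral_lintegral_inv_enorm_sub_pow_le hv hQ hc₄').trans ?_)
  · gcongr
    exact le_self_add
  · gcongr
    exact le_add_self

end Averaging

/-! ### Projected Sobolev maps -/

section Composition

variable {n : ℕ} {V : Type*} [NormedAddCommGroup V] [InnerProductSpace ℝ V]
  [FiniteDimensional ℝ V]
  {Ω : Set (EuclideanSpace ℝ (Fin n))} {v : EuclideanSpace ℝ (Fin n) → V}
  {Dv : Fin n → EuclideanSpace ℝ (Fin n) → V}
  {D2v : Fin n → Fin n → EuclideanSpace ℝ (Fin n) → V}
  {g : EuclideanSpace ℝ (Fin n) → V} {G : Fin n → EuclideanSpace ℝ (Fin n) → V}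

/-- The projection of `v` onto the sphere from `a` is a `W^{2,2}` map, with the boundary data of
`v`, as soon as the singular factors `|v - a|⁻¹` in its derivatives are integrable. It is the limit
of the compositions of `v` with the smooth approximations of the projection, which all have the
same boundary data since they agree with the projection near the sphere. -/
theorem isW22_rayProj_comp [IsFiniteMeasure (volume.restrict Ω)] {a : V} (ha : ‖a‖ ≤ 1 / 2)
    (hv : IsW22 Ω v Dv D2v) (hDv4 : ∀ i, MemLp (Dv i) 4 (volume.restrict Ω))
    (hg : HasTrace Ω v Dv g) (hG : ∀ i, HasTrace Ω (Dv i) (D2v i) (G i))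
    (hgG : ∀ᵐ x ∂(surfaceMeasure Ω), ‖g x‖ = 1 ∧ ∀ i, inner ℝ (g x) (G i x) = 0)
    (hne : ∀ᵐ x ∂(volume.restrict Ω), v x ≠ a)
    (h4 : ∀ i, MemLp (fun x => ‖v x - a‖⁻¹ • Dv i x) 4 (volume.restrict Ω))
    (h2 : ∀ i j, MemLp (fun x => ‖v x - a‖⁻¹ • D2v i j x) 2 (volume.restrict Ω)) :
    IsW22 Ω (fun x => rayProj a (v x - a))
      (fun i x => fderiv ℝ (rayProj a) (v x - a) (Dv i x))
      (fun i j x => fderiv ℝ (fderiv ℝ (rayProj a)) (v x - a) (Dv j x) (Dv i x)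
        + fderiv ℝ (rayProj a) (v x - a) (D2v i j x)) ∧
    HasTrace Ω (fun x => rayProj a (v x - a))
      (fun i x => fderiv ℝ (rayProj a) (v x - a) (Dv i x)) g ∧
    ∀ i, HasTrace Ω (fun x => fderiv ℝ (rayProj a) (v x - a) (Dv i x))
      (fun j x => fderiv ℝ (fderiv ℝ (rayProj a)) (v x - a) (Dv j x) (Dv i x)
        + fderiv ℝ (rayProj a) (v x - a) (D2v i j x)) (G i) := by
  obtain ⟨Ψ, C, hΨ⟩ := exists_smooth_approx_rayProj ha
  have ha1 : ‖a‖ < 1 := ha.trans_lt (by norm_num)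
  have mv := hv.isW12.memLp.1
  have mDv := hv.isW12.memLp_deriv
  have mD2v := fun i => (hv.isW12_deriv i).memLp_deriv
  -- values and derivatives of the approximations away from the centre
  have hval : ∀ (m : ℕ) y, 1 < ((m : ℝ) + 3) * ‖y - a‖ → Ψ m y = rayProj a (y - a) := fun m y hy =>
    ((hΨ m).2.2.2.2.2.2 y hy).eq_of_nhds
  have hd1 : ∀ (m : ℕ) y, 1 < ((m : ℝ) + 3) * ‖y - a‖ →
      fderiv ℝ (Ψ m) y = fderiv ℝ (rayProj a) (y - a) := fun m y hy => by
    rw [((hΨ m).2.2.2.2.2.2 y hy).fderiv_eq, fderiv_comp_sub]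
  have hd2 : ∀ (m : ℕ) y, 1 < ((m : ℝ) + 3) * ‖y - a‖ →
      fderiv ℝ (fderiv ℝ (Ψ m)) y = fderiv ℝ (fderiv ℝ (rayProj a)) (y - a) := fun m y hy => by
    rw [((hΨ m).2.2.2.2.2.2 y hy).fderiv.fderiv_eq]
    have : fderiv ℝ (fun y => rayProj a (y - a)) = fun y => fderiv ℝ (rayProj a) (y - a) := by
      ext1 y
      rw [fderiv_comp_sub]
    rw [this, fderiv_comp_sub]
  have hev : ∀ y, y ≠ a → ∀ᶠ m : ℕ in atTop, 1 < ((m : ℝ) + 3) * ‖y - a‖ := fun y hy => by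
    have hpos : 0 < ‖y - a‖ := norm_pos_iff.2 (sub_ne_zero.2 hy)
    have : Tendsto (fun m : ℕ => ((m : ℝ) + 3) * ‖y - a‖) atTop atTop :=
      (tendsto_atTop_add_const_right _ _ tendsto_natCast_atTop_atTop).atTop_mul_const hpos
    exact this.eventually_gt_atTop 1
  -- `Ψ m` differs from the projection only within `1 / (m + 3) ≤ 1 / 3` of `a`, and the sphere is
  -- at distance at least `1 / 2`
  have hsph : ∀ (m : ℕ) y, ‖y‖ = 1 → 1 < ((m : ℝ) + 3) * ‖y - a‖ := fun m y hy => by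
    have h1 : 1 / 2 ≤ ‖y - a‖ := by
      have := norm_sub_norm_le y a
      rw [hy] at this
      linarith
    have h2 : (0 : ℝ) ≤ m := m.cast_nonneg
    nlinarith
  have bD1 : ∀ m y p, y ≠ a → ‖fderiv ℝ (Ψ m) y p‖ ≤ C * ‖‖y - a‖⁻¹ • p‖ := fun m y p hy => by
    rw [norm_smul, norm_inv, norm_norm, ← mul_assoc]
    exact (ContinuousLinearMap.le_opNorm _ _).trans
      (mul_le_mul_of_nonneg_right ((hΨ m).2.2.2.2.1 y hy) (norm_nonneg _))
  have bD2 : ∀ m y p q, y ≠ a → ‖fderiv ℝ (fderiv ℝ (Ψ m)) y p q‖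
      ≤ C * (‖‖y - a‖⁻¹ • p‖ * ‖‖y - a‖⁻¹ • q‖) := fun m y p q hy => by
    have e : C * (‖‖y - a‖⁻¹ • p‖ * ‖‖y - a‖⁻¹ • q‖) = C * ‖y - a‖⁻¹ ^ 2 * ‖p‖ * ‖q‖ := by
      rw [norm_smul, norm_smul, norm_inv, norm_norm]
      ring
    rw [e]
    refine (ContinuousLinearMap.le_opNorm₂ _ _ _).trans ?_
    gcongr
    exact (hΨ m).2.2.2.2.2.1 y hy
  -- the compositions with the approximations
  have tr1 : ∀ m, HasTrace Ω (fun x => Ψ m (v x)) (fun i x => fderiv ℝ (Ψ m) (v x) (Dv i x)) g := by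
    intro m
    obtain ⟨K, hK⟩ := (hΨ m).2.1
    have e : g =ᵐ[surfaceMeasure Ω] fun x => Ψ m (g x) := by
      filter_upwards [hgG] with x hx
      rw [hval m _ (hsph m _ hx.1), rayProj_sub_of_norm_eq_one ha1 hx.1]
    exact (hg.comp mv mDv (hΨ m).1 hK (hg.1.ae_eq e)).congr e.symm
  have tr2 : ∀ m i, HasTrace Ω (fun x => fderiv ℝ (Ψ m) (v x) (Dv i x))
      (fun j x => fderiv ℝ (fderiv ℝ (Ψ m)) (v x) (Dv j x) (Dv i x)
        + fderiv ℝ (Ψ m) (v x) (D2v i j x)) (G i) := by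
    intro m i
    obtain ⟨K₁, hK₁⟩ := (hΨ m).2.1
    obtain ⟨K₂, hK₂⟩ := (hΨ m).2.2.1
    refine (hg.fderiv_comp_apply (hG i) mv mDv (mDv i) (mD2v i) hDv4 (hDv4 i) (hΨ m).1
      hK₁ hK₂).congr ?_
    filter_upwards [hgG] with x hx
    rw [hd1 m _ (hsph m _ hx.1), fderiv_rayProj_sub_apply ha1 hx.1 (hx.2 i)]
  -- passage to the limit
  have m1 : ∀ m, AEStronglyMeasurable (fun x => Ψ m (v x)) (volume.restrict Ω) := fun m =>
    (hΨ m).1.continuous.comp_aestronglyMeasurable mv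
  have m2 : ∀ m i, AEStronglyMeasurable (fun x => fderiv ℝ (Ψ m) (v x) (Dv i x))
      (volume.restrict Ω) := fun m i =>
    aestronglyMeasurable_fderiv_comp_apply mv (mDv i).1 (hΨ m).1
  have m3 : ∀ m i j, AEStronglyMeasurable (fun x => fderiv ℝ (fderiv ℝ (Ψ m)) (v x) (Dv j x)
      (Dv i x) + fderiv ℝ (Ψ m) (v x) (D2v i j x)) (volume.restrict Ω) := fun m i j =>
    (aestronglyMeasurable_fderiv_fderiv_comp_apply mv (mDv j).1 (mDv i).1 (hΨ m).1).add
      (aestronglyMeasurable_fderiv_comp_apply mv (mD2v i j).1 (hΨ m).1)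
  have t1 := tendsto_eLpNorm_two_of_dominated m1 (memLp_const (2 : ℝ))
    (f₀ := fun x => rayProj a (v x - a))
    (fun m => Eventually.of_forall fun x => (hΨ m).2.2.2.1 _) (by
      filter_upwards [hne] with x hx
      exact tendsto_const_nhds.congr' ((hev _ hx).mono fun m hm => (hval m _ hm).symm))
  have t2 := fun i => tendsto_eLpNorm_two_of_dominated (fun m => m2 m i)
    (((h4 i).mono_exponent (by norm_num)).norm.const_mul C)
    (f₀ := fun x => fderiv ℝ (rayProj a) (v x - a) (Dv i x))
    (fun m => hne.mono fun x hx => bD1 m _ _ hx) (by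
      filter_upwards [hne] with x hx
      exact tendsto_const_nhds.congr' ((hev _ hx).mono fun m hm => by simp only [hd1 m _ hm]))
  have t3 := fun i j => tendsto_eLpNorm_two_of_dominated (fun m => m3 m i j)
    (((memLp_two_norm_mul_norm (h4 j) (h4 i)).const_mul C).add ((h2 i j).norm.const_mul C))
    (f₀ := fun x => fderiv ℝ (fderiv ℝ (rayProj a)) (v x - a) (Dv j x) (Dv i x)
      + fderiv ℝ (rayProj a) (v x - a) (D2v i j x))
    (fun m => hne.mono fun x hx => (norm_add_le _ _).trans
      (add_le_add (bD2 m _ _ _ hx) (bD1 m _ _ hx))) (by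
      filter_upwards [hne] with x hx
      exact tendsto_const_nhds.congr' ((hev _ hx).mono fun m hm => by
        simp only [hd1 m _ hm, hd2 m _ hm]))
  have trw : HasTrace Ω (fun x => rayProj a (v x - a))
      (fun i x => fderiv ℝ (rayProj a) (v x - a) (Dv i x)) g :=
    HasTrace.of_tendsto tr1 m1 t1.1.1 m2 (fun i => (t2 i).1.1) hg.1.1 t1.2 (fun i => (t2 i).2)
      (by simp)
  have trDw : ∀ i, HasTrace Ω (fun x => fderiv ℝ (rayProj a) (v x - a) (Dv i x))
      (fun j x => fderiv ℝ (fderiv ℝ (rayProj a)) (v x - a) (Dv j x) (Dv i x)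
        + fderiv ℝ (rayProj a) (v x - a) (D2v i j x)) (G i) := fun i =>
    HasTrace.of_tendsto (fun m => tr2 m i) (fun m => m2 m i) (t2 i).1.1 (fun m j => m3 m i j)
      (fun j => (t3 i j).1.1) (hG i).1.1 (t2 i).2 (fun j => (t3 i j).2) (by simp)
  exact ⟨⟨trw.isW12 t1.1 fun i => (t2 i).1, fun i => (trDw i).isW12 (t2 i).1 fun j => (t3 i j).1⟩,
    trw, trDw⟩

omit [FiniteDimensional ℝ V] in
/-- The Laplacian of the projected map is `∑ᵢ D²P(v)(∂ᵢv, ∂ᵢv) + DP(v) Δv`, so only `Δv` enters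
among the second derivatives of `v`. -/
theorem norm_sq_laplacian_rayProj_comp_le {C : ℝ} {a : V} {x : EuclideanSpace ℝ (Fin n)}
    (hx : v x ≠ a)
    (h1 : ‖fderiv ℝ (rayProj a) (v x - a)‖ ≤ C * ‖v x - a‖⁻¹)
    (h2 : ‖fderiv ℝ (fderiv ℝ (rayProj a)) (v x - a)‖ ≤ C * ‖v x - a‖⁻¹ ^ 2) :
    ‖laplacian (fun i j x => fderiv ℝ (fderiv ℝ (rayProj a)) (v x - a) (Dv j x) (Dv i x)
        + fderiv ℝ (rayProj a) (v x - a) (D2v i j x)) x‖ ^ 2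
      ≤ 2 * C ^ 2 * (‖laplacian D2v x‖ ^ 2 * ‖v x - a‖⁻¹ ^ 2
        + gradNormSq Dv x ^ 2 * ‖v x - a‖⁻¹ ^ 4) := by
  unfold laplacian gradNormSq
  have hb : 0 < ‖v x - a‖⁻¹ := inv_pos.2 (norm_pos_iff.2 (sub_ne_zero.2 hx))
  generalize ‖v x - a‖⁻¹ = b at hb h1 h2 ⊢
  have e1 : ‖∑ i, fderiv ℝ (fderiv ℝ (rayProj a)) (v x - a) (Dv i x) (Dv i x)‖
      ≤ C * b ^ 2 * ∑ i, ‖Dv i x‖ ^ 2 := by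
    rw [Finset.mul_sum]
    refine norm_sum_le_of_le _ fun i _ => (ContinuousLinearMap.le_opNorm₂ _ _ _).trans ?_
    rw [mul_assoc, ← pow_two]
    gcongr
  have e2 : ‖∑ i, fderiv ℝ (rayProj a) (v x - a) (D2v i i x)‖ ≤ C * b * ‖∑ i, D2v i i x‖ := by
    rw [← map_sum]
    exact (ContinuousLinearMap.le_opNorm _ _).trans (by gcongr)
  rw [Finset.sum_add_distrib]
  have e3 := (norm_add_le _ _).trans (add_le_add e1 e2)
  refine (pow_le_pow_left₀ (norm_nonneg _) e3 2).trans ?_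
  refine add_sq_le.trans_eq ?_
  ring

end Composition

end SphereExtension

theorem lemma2p1 (n k : ℕ) (hn : 5 ≤ n) (hk : 4 ≤ k) :
    ∃ C : ℝ, 0 < C ∧
      ∀ Ω : Set (EuclideanSpace ℝ (Fin n)), SphereExtension.IsBoundedSmoothDomain Ω →
      ∀ (v : EuclideanSpace ℝ (Fin n) → EuclideanSpace ℝ (Fin (k + 1)))
        (Dv : Fin n → EuclideanSpace ℝ (Fin n) → EuclideanSpace ℝ (Fin (k + 1)))
        (D2v : Fin n → Fin n → EuclideanSpace ℝ (Fin n) → EuclideanSpace ℝ (Fin (k + 1))),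
        SphereExtension.IsW22 Ω v Dv D2v →
        (∀ i, MemLp (Dv i) 4 (volume.restrict Ω)) →
      ∀ (g : EuclideanSpace ℝ (Fin n) → EuclideanSpace ℝ (Fin (k + 1)))
        (G : Fin n → EuclideanSpace ℝ (Fin n) → EuclideanSpace ℝ (Fin (k + 1))),
        SphereExtension.HasTrace Ω v Dv g →
        (∀ i, SphereExtension.HasTrace Ω (Dv i) (D2v i) (G i)) →
        (∀ᵐ x ∂(SphereExtension.surfaceMeasure Ω), ‖g x‖ = 1 ∧ ∀ i, inner ℝ (g x) (G i x) = 0) →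
      ∃ (w : EuclideanSpace ℝ (Fin n) → EuclideanSpace ℝ (Fin (k + 1)))
        (Dw : Fin n → EuclideanSpace ℝ (Fin n) → EuclideanSpace ℝ (Fin (k + 1)))
        (D2w : Fin n → Fin n → EuclideanSpace ℝ (Fin n) → EuclideanSpace ℝ (Fin (k + 1))),
        SphereExtension.IsW22 Ω w Dw D2w ∧
        (∀ᵐ x ∂(volume.restrict Ω), ‖w x‖ = 1) ∧
        SphereExtension.HasTrace Ω w Dw g ∧
        (∀ i, SphereExtension.HasTrace Ω (Dw i) (D2w i) (G i)) ∧
        ∫ x in Ω, ‖SphereExtension.laplacian D2w x‖ ^ 2 ≤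
          C * ∫ x in Ω, (‖SphereExtension.laplacian D2v x‖ ^ 2 +
            (SphereExtension.gradNormSq Dv x) ^ 2) := by
  open SphereExtension in
  have hfr : Module.finrank ℝ (EuclideanSpace ℝ (Fin (k + 1))) = k + 1 := by simp
  obtain ⟨C₀, hC₀, hbd⟩ := exists_fderiv_rayProj_bound (EuclideanSpace ℝ (Fin (k + 1)))
  obtain ⟨A, hA, hcen⟩ := exists_center (EuclideanSpace ℝ (Fin (k + 1))) (by omega)
  -- `A` is only known to be finite; adding `1` makes the constant positive
  refine ⟨2 * C₀ ^ 2 * (A.toReal + 1), by positivity, ?_⟩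
  intro Ω hΩ v Dv D2v hv hDv4 g G hg hG hgG
  have hfin : IsFiniteMeasure (volume.restrict Ω) := ⟨by
    rw [Measure.restrict_apply_univ]
    exact hΩ.isBounded.measure_lt_top⟩
  have mv := hv.isW12.memLp.1
  have mD2v := fun i => (hv.isW12_deriv i).memLp_deriv
  have hlap : MemLp (laplacian D2v) 2 (volume.restrict Ω) :=
    memLp_finsetSum _ fun i _ => mD2v i i
  have hgrad : MemLp (gradNormSq Dv) 2 (volume.restrict Ω) := by
    refine memLp_finsetSum _ fun i _ => ?_
    simpa only [pow_two] using memLp_two_norm_mul_norm (hDv4 i) (hDv4 i)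
  have hint : Integrable (fun x => ‖laplacian D2v x‖ ^ 2 + (gradNormSq Dv x) ^ 2)
      (volume.restrict Ω) := hlap.norm.integrable_sq.add hgrad.integrable_sq
  have hgood : ∀ᵐ a ∂(volume.restrict (Metric.ball (0 : EuclideanSpace ℝ (Fin (k + 1))) (1 / 2))),
      (∀ᵐ x ∂(volume.restrict Ω), v x ≠ a) ∧
      (∀ i, MemLp (fun x => ‖v x - a‖⁻¹ • Dv i x) 4 (volume.restrict Ω)) ∧
      ∀ i j, MemLp (fun x => ‖v x - a‖⁻¹ • D2v i j x) 2 (volume.restrict Ω) := by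
    refine (ae_ae_ne mv (by omega)).and ((ae_all_iff.2 fun i => ?_).and
      (ae_all_iff.2 fun i => ae_all_iff.2 fun j => ?_))
    · exact ae_memLp_inv_norm_sub_smul mv (p := 4) (by norm_num) (by omega) (hDv4 i)
    · exact ae_memLp_inv_norm_sub_smul mv (p := 2) (by norm_num) (by omega) (mD2v i j)
  obtain ⟨a, ha, ⟨hne, h4, h2⟩, hle⟩ := hcen (volume.restrict Ω) v mv
    (fun x => ENNReal.ofReal (‖laplacian D2v x‖ ^ 2))
    (fun x => ENNReal.ofReal ((gradNormSq Dv x) ^ 2))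
    (hlap.1.norm.aemeasurable.pow_const 2).ennreal_ofReal
    (hgrad.1.aemeasurable.pow_const 2).ennreal_ofReal _ hgood
  obtain ⟨hw, hwg, hwG⟩ := isW22_rayProj_comp ha hv hDv4 hg hG hgG hne h4 h2
  refine ⟨_, _, _, hw, ?_, hwg, hwG, ?_⟩
  · filter_upwards [hne] with x hx
    exact norm_rayProj (ha.trans_lt (by norm_num)) (sub_ne_zero.2 hx)
  · have hlw : AEStronglyMeasurable (laplacian fun i j x =>
        fderiv ℝ (fderiv ℝ (rayProj a)) (v x - a) (Dv j x) (Dv i x)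
        + fderiv ℝ (rayProj a) (v x - a) (D2v i j x)) (volume.restrict Ω) :=
      (memLp_finsetSum (p := 2) _ fun i _ => (hw.isW12_deriv i).memLp_deriv i).1
    rw [integral_eq_lintegral_of_nonneg_ae (Eventually.of_forall fun x => by positivity)
      (hlw.norm.aemeasurable.pow_const 2).aestronglyMeasurable]
    have hI : 0 ≤ ∫ x in Ω, (‖laplacian D2v x‖ ^ 2 + (gradNormSq Dv x) ^ 2) :=
      integral_nonneg fun x => by positivity
    refine ENNReal.toReal_le_of_le_ofReal (by positivity) ?_
    calc ∫⁻ x in Ω, ENNReal.ofReal (‖laplacian (fun i j x =>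
            fderiv ℝ (fderiv ℝ (rayProj a)) (v x - a) (Dv j x) (Dv i x)
            + fderiv ℝ (rayProj a) (v x - a) (D2v i j x)) x‖ ^ 2)
        ≤ ∫⁻ x in Ω, ENNReal.ofReal (2 * C₀ ^ 2) *
          (ENNReal.ofReal (‖laplacian D2v x‖ ^ 2) * (‖v x - a‖ₑ⁻¹) ^ 2
            + ENNReal.ofReal ((gradNormSq Dv x) ^ 2) * (‖v x - a‖ₑ⁻¹) ^ 4) := by
          refine lintegral_mono_ae ?_
          filter_upwards [hne] with x hx
          have hpos : 0 < ‖v x - a‖ := norm_pos_iff.2 (sub_ne_zero.2 hx)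
          obtain ⟨b1, b2⟩ := hbd a (v x - a) ha (sub_ne_zero.2 hx)
          refine (ENNReal.ofReal_le_ofReal
            (norm_sq_laplacian_rayProj_comp_le hx b1 b2)).trans_eq ?_
          rw [← ofReal_norm (v x - a), ← ENNReal.ofReal_inv_of_pos hpos,
            ← ENNReal.ofReal_pow (by positivity), ← ENNReal.ofReal_pow (by positivity),
            ← ENNReal.ofReal_mul (by positivity), ← ENNReal.ofReal_mul (by positivity),
            ← ENNReal.ofReal_add (by positivity) (by positivity),
            ← ENNReal.ofReal_mul (by positivity)]
      _ ≤ ENNReal.ofReal (2 * C₀ ^ 2) * (A * ∫⁻ x in Ω,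
          (ENNReal.ofReal (‖laplacian D2v x‖ ^ 2) + ENNReal.ofReal ((gradNormSq Dv x) ^ 2))) := by
          rw [lintegral_const_mul' _ _ ENNReal.ofReal_ne_top]
          gcongr
      _ = ENNReal.ofReal (2 * C₀ ^ 2) * (A * ENNReal.ofReal (∫ x in Ω,
          (‖laplacian D2v x‖ ^ 2 + (gradNormSq Dv x) ^ 2))) := by
          rw [ofReal_integral_eq_lintegral_ofReal hint
            (Eventually.of_forall fun x => by positivity)]
          congr 2
          refine lintegral_congr fun x => ?_
          rw [ENNReal.ofReal_add (by positivity) (by positivity)]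
      _ ≤ ENNReal.ofReal (2 * C₀ ^ 2 * (A.toReal + 1) *
          ∫ x in Ω, (‖laplacian D2v x‖ ^ 2 + (gradNormSq Dv x) ^ 2)) := by
          rw [ENNReal.ofReal_mul (p := 2 * C₀ ^ 2 * (A.toReal + 1)) (by positivity),
            ENNReal.ofReal_mul (p := 2 * C₀ ^ 2) (by positivity),
            mul_assoc (ENNReal.ofReal (2 * C₀ ^ 2))]
          refine mul_le_mul' le_rfl (mul_le_mul' ?_ le_rfl)
          refine (ENNReal.le_ofReal_iff_toReal_le hA (by positivity)).2 ?_
          linarith
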